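/- **Setting.** Let $D$ be a link diagram on the oriented sphere that is connected and has at least one crossing, and in which every component of the link passes over at some crossing and under at some crossing. (Every diagram of a hyperbolic link $L$ has these properties, and hyperbolicity is not needed otherwise.) The arcs between adjacent crossings are called sides; assign complex variables $z_1,\dots,z_n$ to the sides. At a crossing $k$ denote by $z_a,z_b,z_c,z_d$ the variables of the four sides in counterclockwise order, the over-strand joining $a$ to $c$ and the under-strand joining $b$ to $d$. The potential function is $$V(z_1,\dots,z_n)=\sum_{\text{crossings}}\Big\{\mathrm{Li}_2\big(\tfrac{z_b}{z_a}\big)-\mathrm{Li}_2\big(\tfrac{z_b}{z_c}\big)+\mathrm{Li}_2\big(\tfrac{z_d}{z_c}\big)-\mathrm{Li}_2\big(\tfrac{z_d}{z_a}\big)\Big\},$$ where $\mathrm{Li}_2$ is the (multivalued) dilogarithm, and $\mathcal H=\{\exp(z_k\,\partial V/\partial z_k)=1\mid k=1,\dots,n\}$. Only points $z\in\mathbb C^n$ are considered at which all $z_k\neq 0$ and no ratio inside a dilogarithm of $V$ equals $1$. The *octahedral triangulation* of $\mathbb S^3\setminus(L\cup\{\text{two points}\})$ has at each crossing $k$ an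 ideal octahedron with horizontal vertices $A_k,B_k,C_k,D_k$ at the ends $a,b,c,d$, a vertex $F_k$ on the over-strand and a vertex $E_k$ on the under-strand, divided into the four tetrahedra $A_kB_kE_kF_k$, $B_kC_kE_kF_k$, $C_kD_kE_kF_k$, $D_kA_kE_kF_k$. The two outer faces at an over-end $h\in\{A_k,C_k\}$ that contain the edge $hF_k$, and those at an under-end $h\in\{B_k,D_k\}$ that contain the edge $hE_k$, are glued along the corresponding side to the two outer faces at the other end of the side, so that faces in the same region of the diagram are glued to each other, the vertices $A,C$ are glued to $A,C$, the vertices $B,D$ to $B,D$, and the vertices $E,F$ to $E,F$. The shape parameters of the four tetrahedra at the edges $A_kB_k$, $B_kC_k$, $C_kD_k$, $D_kA_k$ are $\frac{z_b}{z_a},\frac{z_c}{z_b},\frac{z_d}{z_c},\frac{z_a}{z_d}$; if an edge of a tetrahedron has parameter $u$, so does the opposite edge, and the others have parameters $\frac1{1-u}$ and $1-\frac1u$, in the usual cyclic order. The *hyperbolicity equations* are Thurston's gluing equations (at every edge the product of the parameters is $1$) together with the completeness conditions (the holonomy of the meridian and of the longitude of every component of the link acts as a translation on the cusp). A side is *alternating*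 if it joins an over-crossing to an under-crossing; it then carries a meridian loop on the cusp. A non-alternating side determines an edge of the triangulation, namely the common edge $CF$ of its two octahedra (over to over, $C$ being the vertex of each octahedron at the side) or $BE$ (under to under). **Statement.** At every such point $z$, and for every choice of the branches of the dilogarithms (such choices exist): 1. the equation of $\mathcal H$ for an alternating side is equivalent to the completeness condition along the meridian of that side, and the equation of $\mathcal H$ for a non-alternating side is equivalent to the gluing equation of the edge determined by that side; 2. $z$ satisfies $\mathcal H$ if and only if it satisfies the gluing equations of all edges of the octahedral triangulation and the completeness conditions along all meridians; 3. if $z$ satisfies $\mathcal H$, the completeness condition along the longitude holds for every component whose meridian acts non-trivially on its cusp (its holonomy is not the identity); 4. consequently, $\mathcal H$ is equivalent to the whole set of hyperbolicity equations, always if $L$ is a knot, and for a link at every $z$ at which no meridian has trivial holonomy. -/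

import Mathlib

/-! ## Ideal triangulations, gluing equations and cusp holonomies -/

/-- An oriented ideal triangulation: finitely many ideal tetrahedra whose facets are glued in pairs.
The vertices of every tetrahedron are numbered `0, 1, 2, 3` so that, seen from the vertex `0`, the
vertices `1, 2, 3` appear counterclockwise. The facet of `t` opposite to the vertex `v` is glued to
the facet of `nbr t v` opposite to the vertex `perm t v v`, and each vertex `w ≠ v` of that facet
is glued to the vertex `perm t v w`. -/
structure IdealTriangulation where
  Tet : Type
  fintypeTet : Fintype Tet
  nbr : Tet → Fin 4 → Tet
  perm : Tet → Fin 4 → Equiv.Perm (Fin 4)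
  nbr_nbr : ∀ t v, nbr (nbr t v) (perm t v v) = t
  perm_nbr : ∀ t v, perm (nbr t v) (perm t v v) = (perm t v)⁻¹
  facet_ne : ∀ t v, (nbr t v, perm t v v) ≠ (t, v)
  perm_odd : ∀ t v, Equiv.Perm.sign (perm t v) = -1

attribute [instance] IdealTriangulation.fintypeTet

/-- The parameter carried by an edge of an ideal tetrahedron whose edge `01` carries the shape
parameter `u`: opposite edges carry the same parameter, and around a vertex, counterclockwise, the
three edges carry `u`, `u' = 1 / (1 - u)` and `u'' = 1 - 1 / u`. -/
noncomputable def edgeParam (u : ℂ) (e : Sym2 (Fin 4)) : ℂ :=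
  if e = s(0, 1) ∨ e = s(2, 3) then u
  else if e = s(0, 2) ∨ e = s(1, 3) then 1 / (1 - u)
  else 1 - 1 / u

namespace IdealTriangulation

variable (T : IdealTriangulation)

/-- The edges of the tetrahedra, before gluing. -/
abbrev TetEdge : Type := T.Tet × {e : Sym2 (Fin 4) // ¬ e.IsDiag}

/-- Two edges of tetrahedra are identified by the gluing of a facet `v` containing the first. -/
def EdgeGlued (a b : T.TetEdge) : Prop :=
  ∃ v : Fin 4, v ∉ a.2.1 ∧ b.1 = T.nbr a.1 v ∧ b.2.1 = Sym2.map (T.perm a.1 v) a.2.1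

/-- The edges of the triangulation: classes of edges of tetrahedra under the gluing. -/
def Edge : Type := Quot T.EdgeGlued

open Classical in
/-- Thurston's gluing equation of an edge of the triangulation, for the shape parameters `u`: the
product of the parameters of all the edges of tetrahedra glued to it is one. -/
def GluingEquation (u : T.Tet → ℂ) (e : T.Edge) : Prop :=
  ∏ a ∈ Finset.univ.filter (fun a : T.TetEdge => Quot.mk T.EdgeGlued a = e),
    edgeParam (u a.1) a.2.1 = 1

/-- The link of an ideal vertex `v` of a tetrahedron is a triangle whose corners lie on the three
edges issuing from `v`. The pair `(t, σ)` stands for the directed edge from the corner `σ 1` to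
the corner `σ 2` in the link of the vertex `σ 0` of `t`; the third corner of this triangle
is `σ 3`. -/
abbrev CuspEdge : Type := T.Tet × Equiv.Perm (Fin 4)

end IdealTriangulation

/-- The elementary moves of a directed edge on the triangulated cross-section of a cusp: turn it
about its initial point, inside its triangle, to the other side issuing from that point; reverse it;
pass to the adjacent triangle that contains it. -/
inductive CuspMove
  | turn
  | flip
  | cross

namespace IdealTriangulation

variable (T : IdealTriangulation)

/-- The directed edge obtained by one move. -/
def step (m : CuspMove) (s : T.CuspEdge) : T.CuspEdge :=
  match m with
  | .turn => (s.1, s.2 * Equiv.swap 2 3)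
  | .flip => (s.1, s.2 * Equiv.swap 1 2)
  | .cross => (T.nbr s.1 (s.2 3), T.perm s.1 (s.2 3) * s.2)

/-- The directed edge obtained by a sequence of moves. -/
def endpoint : List CuspMove → T.CuspEdge → T.CuspEdge
  | [], s => s
  | m :: ms, s => endpoint ms (T.step m s)

/-- The factor by which a move multiplies the developed image in `ℂ` of a directed edge. A turn
from the side `xy` to the side `xz` of a triangle multiplies it by the parameter of the corner `x`
if `x, y, z` are counterclockwise, seen from the cusp, and by its inverse otherwise. -/
noncomputable def factor (u : T.Tet → ℂ) (m : CuspMove) (s : T.CuspEdge) : ℂ :=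
  match m with
  | .turn => edgeParam (u s.1) s(s.2 0, s.2 1) ^ ((Equiv.Perm.sign s.2 : ℤˣ) : ℤ)
  | .flip => -1
  | .cross => 1

/-- The displacement of the initial point of a directed edge under a move, the developed image of
the directed edge being the vector `1`. -/
def displacement (m : CuspMove) : ℂ :=
  match m with
  | .turn => 0
  | .flip => 1
  | .cross => 0

/-- Develop a sequence of moves in `ℂ`, the starting edge being developed to the vector `1` based at
the point `0`. This is the vector to which the final edge is developed. -/
noncomputable def dilation (u : T.Tet → ℂ) : List CuspMove → T.CuspEdge → ℂ
  | [], _ => 1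
  | m :: ms, s => T.factor u m s * dilation u ms (T.step m s)

/-- Develop a sequence of moves in `ℂ`, the starting edge being developed to the vector `1` based at
the point `0`. This is the point to which the initial point of the final edge is developed. -/
noncomputable def translation (u : T.Tet → ℂ) : List CuspMove → T.CuspEdge → ℂ
  | [], _ => 0
  | m :: ms, s => displacement m + T.factor u m s * translation u ms (T.step m s)

/-- A closed curve on the cross-section of a cusp. Its holonomy is the similarity
`w ↦ dilation * w + translation` of `ℂ`. -/
structure CuspLoop where
  base : T.CuspEdge
  moves : List CuspMove
  closed : T.endpoint moves base = base

variable {T}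

/-- The holonomy of the closed curve is a translation (possibly trivial): this is the completeness
condition along the curve. -/
def CuspLoop.Complete (c : T.CuspLoop) (u : T.Tet → ℂ) : Prop :=
  T.dilation u c.moves c.base = 1

/-- The holonomy of the closed curve is the identity. -/
def CuspLoop.TrivialHolonomy (c : T.CuspLoop) (u : T.Tet → ℂ) : Prop :=
  T.dilation u c.moves c.base = 1 ∧ T.translation u c.moves c.base = 0

theorem endpoint_append (T : IdealTriangulation) (l l' : List CuspMove) (s : T.CuspEdge) :
    T.endpoint (l ++ l') s = T.endpoint l' (T.endpoint l s) := by
  induction l generalizing s with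
  | nil => rfl
  | cons m l ih => exact ih _

end IdealTriangulation

/-! ## Link diagrams -/

/-- A connected link diagram on the oriented sphere, with at least one crossing, as a 4-valent
combinatorial map. The four ends at a crossing `k` are `(k, 0), (k, 1), (k, 2), (k, 3)`, in
counterclockwise order; the over-strand runs through the ends `0` and `2`, and the under-strand
through the ends `1` and `3`. The map `opp` sends an end of a side to the other end of that side. -/
structure LinkDiagram where
  Crossing : Type
  fintypeCrossing : Fintype Crossing
  opp : Crossing × Fin 4 → Crossing × Fin 4
  opp_opp : ∀ d, opp (opp d) = d
  opp_ne : ∀ d, opp d ≠ d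
  /-- The diagram is connected. -/
  connected : ∀ d d' : Crossing × Fin 4,
    Relation.ReflTransGen (fun x y => y = opp x ∨ y.1 = x.1) d d'
  /-- The diagram is spherical, by Euler's formula: the boundary of a region, followed from end to
  end, is an orbit of `d ↦ opp d` followed by a quarter turn, and the number of regions is the
  number of crossings plus two. -/
  spherical :
    Nat.card (Quot (fun d d' : Crossing × Fin 4 => d' = ((opp d).1, (opp d).2 + 1))) =
      Fintype.card Crossing + 2

attribute [instance] LinkDiagram.fintypeCrossing

/-- The number of an end of the over-strand. -/
def OverEnd (j : Fin 4) : Prop := j = 0 ∨ j = 2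

instance : DecidablePred OverEnd := fun j => inferInstanceAs (Decidable (j = 0 ∨ j = 2))

namespace LinkDiagram

variable (D : LinkDiagram)

/-- The ends of the sides of the diagram. -/
abbrev End : Type := D.Crossing × Fin 4

/-- Two ends belong to the same side. -/
def sideSetoid : Setoid D.End where
  r d d' := d' = d ∨ d' = D.opp d
  iseqv :=
    { refl := fun _ => Or.inl rfl
      symm := by
        rintro d d' (h | h)
        · exact Or.inl h.symm
        · exact Or.inr (by rw [h, D.opp_opp])
      trans := by
        rintro d d' d'' (rfl | rfl) (rfl | rfl)
        · exact Or.inl rfl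
        · exact Or.inr rfl
        · exact Or.inr rfl
        · exact Or.inl (D.opp_opp d) }

/-- The sides of the diagram: the arcs connecting two adjacent crossing points. -/
def Side : Type := Quotient D.sideSetoid

/-- The side of an end. -/
def side (d : D.End) : D.Side := Quotient.mk D.sideSetoid d

/-- The components of the link: the classes of ends under following a side and going straight
through a crossing. -/
def Component : Type := Quot (fun d d' : D.End => d' = D.opp d ∨ d' = (d.1, d.2 + 2))

/-- The component of an end. -/
def component (d : D.End) : D.Component := Quot.mk _ d

/-- The link is a knot. -/
def IsKnot : Prop := Subsingleton D.Component

/-- Every component of the link passes over at some crossing and passes under at some crossing. (A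
component that does not would be an unknot split from the rest of the link, so this holds for
every diagram of a hyperbolic link.) -/
def EveryComponentOverAndUnder : Prop :=
  ∀ c : D.Component, (∃ d, D.component d = c ∧ OverEnd d.2) ∧
    (∃ d, D.component d = c ∧ ¬ OverEnd d.2)

/-- The side with end `d` goes from an over-crossing to an under-crossing. -/
def Alternating (d : D.End) : Prop := ¬ (OverEnd d.2 ↔ OverEnd (D.opp d).2)

end LinkDiagram

/-! ## The potential function -/

/-- The principal branch of the dilogarithm `Li₂(u) = -∫₀ᵘ log(1 - s) / s ds`, the integral being
taken along the segment `s = t u`. -/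
noncomputable def dilog (u : ℂ) : ℂ :=
  -∫ t in (0 : ℝ)..1, Complex.log (1 - (t : ℂ) * u) / (t : ℂ)

/-- Near `u`, the function `f` is a branch of the dilogarithm: it arises by analytic continuation
of the principal branch along a path in `ℂ \ {0, 1}` from `1 / 2` to `u`. -/
def IsDilogBranch (f : ℂ → ℂ) (u : ℂ) : Prop :=
  ∃ (γ : Path (1 / 2 : ℂ) u) (F : unitInterval → ℂ → ℂ),
    (∀ t, γ t ≠ 0 ∧ γ t ≠ 1) ∧
    (∀ t, AnalyticAt ℂ (F t) (γ t)) ∧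
    (∀ t, ∀ᶠ s in nhds t, F s =ᶠ[nhds (γ s)] F t) ∧
    F 0 =ᶠ[nhds (1 / 2 : ℂ)] dilog ∧
    f =ᶠ[nhds u] F 1

namespace LinkDiagram

variable (D : LinkDiagram)

/-- The ratio of side variables inside the dilogarithm of the corner `i` of a crossing `k`, that is
the corner between the ends `i` and `i + 1`. With `a, b, c, d` the ends `0, 1, 2, 3`, the four
ratios are `z_b / z_a`, `z_b / z_c`, `z_d / z_c` and `z_d / z_a`. -/
noncomputable def cornerRatio (z : D.Side → ℂ) (k : D.Crossing) : Fin 4 → ℂ :=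
  ![z (D.side (k, 1)) / z (D.side (k, 0)), z (D.side (k, 1)) / z (D.side (k, 2)),
    z (D.side (k, 3)) / z (D.side (k, 2)), z (D.side (k, 3)) / z (D.side (k, 0))]

/-- The side variables are nonzero and no ratio inside a dilogarithm of the potential function lies
in `{0, 1, ∞}`. -/
def Essential (z : D.Side → ℂ) : Prop :=
  (∀ s, z s ≠ 0) ∧ ∀ k i, D.cornerRatio z k i ≠ 1

/-- The potential function of the diagram, where `f k i` is the branch of the dilogarithm that is
used at the corner `i` of the crossing `k`. -/
noncomputable def potential (f : D.Crossing → Fin 4 → ℂ → ℂ) (z : D.Side → ℂ) : ℂ :=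
  ∑ k : D.Crossing,
    (f k 0 (D.cornerRatio z k 0) - f k 1 (D.cornerRatio z k 1)
      + f k 2 (D.cornerRatio z k 2) - f k 3 (D.cornerRatio z k 3))

/-- The functions `f k i` are branches of the dilogarithm near the ratios at `z`, so that
`D.potential f` is a branch of the potential function near `z`. -/
def IsBranchAt (f : D.Crossing → Fin 4 → ℂ → ℂ) (z : D.Side → ℂ) : Prop :=
  ∀ k i, IsDilogBranch (f k i) (D.cornerRatio z k i)

open Classical in
/-- The equation `exp (z_s ∂V/∂z_s) = 1` of the side `s`, at the point `z`. -/
def PotentialEquation (f : D.Crossing → Fin 4 → ℂ → ℂ) (z : D.Side → ℂ) (s : D.Side) : Prop :=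
  Complex.exp (z s * deriv (fun w => D.potential f (Function.update z s w)) (z s)) = 1

/-- The point `z` satisfies all the equations of the set `H`. -/
def SatisfiesH (f : D.Crossing → Fin 4 → ℂ → ℂ) (z : D.Side → ℂ) : Prop :=
  ∀ s, D.PotentialEquation f z s

/-! ## The octahedral triangulation

The octahedron at the crossing `k` has the horizontal vertices `H₀ = A`, `H₁ = B`, `H₂ = C`,
`H₃ = D`, one at each of the four ends, the vertex `F` on the over-strand and the vertex `E` on the
under-strand. It is divided into the four tetrahedra `(k, i)` with vertices `Hᵢ, Hᵢ₊₁, F, E`,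
numbered `0, 1, 2, 3` in this order. All arithmetic with the indices in `Fin 4` is modulo 4. -/

/-- The tetrahedron `(k, i)` has one outer facet with the vertex `E`, opposite to the vertex `2`,
and one with the vertex `F`, opposite to the vertex `3`. The former is glued along the side that
starts at the under-end among `i, i + 1`, the latter along the side that starts at the over-end. -/
def outerEnd (i v : Fin 4) : Fin 4 :=
  if OverEnd i ↔ v = 3 then i else i + 1

/-- The tetrahedron glued to the facet of `t` opposite to the vertex `v`. Across a side of the
diagram, a tetrahedron is glued to the one in the same region of the diagram. -/
def octNbr (t : D.End) (v : Fin 4) : D.End :=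
  if v = 0 then (t.1, t.2 + 1)
  else if v = 1 then (t.1, t.2 - 1)
  else if outerEnd t.2 v = t.2 then
    ((D.opp (t.1, outerEnd t.2 v)).1, (D.opp (t.1, outerEnd t.2 v)).2 - 1)
  else D.opp (t.1, outerEnd t.2 v)

/-- The identification of the vertices. Inside an octahedron `E`, `F` and the common horizontal
vertex are fixed. Across a side of the diagram, `A, C` are glued to `A, C`, and `B, D` to `B, D`,
and the vertex `E` or `F` at one end to the vertex `E` or `F` at the other end. If every component
of the link passes over and under, this gluing also identifies the edges `BF` and `DF`, and the
edges `AE` and `CE`, of each octahedron. -/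
def octPerm (t : D.End) (v : Fin 4) : Equiv.Perm (Fin 4) :=
  if v = 0 ∨ v = 1 then Equiv.swap 0 1
  else if OverEnd (outerEnd t.2 v) ↔ OverEnd (D.opp (t.1, outerEnd t.2 v)).2 then Equiv.swap 0 1
  else Equiv.swap 2 3

theorem fin4_cases (i : Fin 4) : i = 0 ∨ i = 1 ∨ i = 2 ∨ i = 3 := by
  revert i; decide

theorem opp_cases (k : D.Crossing) (i : Fin 4) :
    ∃ k' j, (j = 0 ∨ j = 1 ∨ j = 2 ∨ j = 3) ∧ D.opp (k, i) = (k', j) ∧ D.opp (k', j) = (k, i) :=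
  ⟨(D.opp (k, i)).1, (D.opp (k, i)).2, fin4_cases _, rfl, D.opp_opp (k, i)⟩

theorem swaps : (Equiv.swap 0 1 : Equiv.Perm (Fin 4)) 2 = 2 ∧
    (Equiv.swap 0 1 : Equiv.Perm (Fin 4)) 3 = 3 ∧
    (Equiv.swap 2 3 : Equiv.Perm (Fin 4)) 0 = 0 ∧
    (Equiv.swap 2 3 : Equiv.Perm (Fin 4)) 1 = 1 ∧ (-1 : Fin 4) = 3 := by decide

theorem octGlue (t : D.End) (v : Fin 4) :
    D.octNbr (D.octNbr t v) (D.octPerm t v v) = t ∧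
      D.octPerm (D.octNbr t v) (D.octPerm t v v) = (D.octPerm t v)⁻¹ ∧
      (D.octNbr t v, D.octPerm t v v) ≠ (t, v) := by
  obtain ⟨k, i⟩ := t
  obtain ⟨k0, j0, c0, h0, h0'⟩ := D.opp_cases k 0
  obtain ⟨k1, j1, c1, h1, h1'⟩ := D.opp_cases k 1
  obtain ⟨k2, j2, c2, h2, h2'⟩ := D.opp_cases k 2
  obtain ⟨k3, j3, c3, h3, h3'⟩ := D.opp_cases k 3
  rcases fin4_cases v with rfl | rfl | rfl | rfl
  · simp [octNbr, octPerm]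
  · simp [octNbr, octPerm]
  · rcases fin4_cases i with rfl | rfl | rfl | rfl
    · rcases c1 with rfl | rfl | rfl | rfl <;>
        simp [octNbr, octPerm, outerEnd, OverEnd, h1, h1', swaps]
    · rcases c1 with rfl | rfl | rfl | rfl <;>
        simp [octNbr, octPerm, outerEnd, OverEnd, h1, h1', swaps]
    · rcases c3 with rfl | rfl | rfl | rfl <;>
        simp [octNbr, octPerm, outerEnd, OverEnd, h3, h3', swaps]
    · rcases c3 with rfl | rfl | rfl | rfl <;>
        simp [octNbr, octPerm, outerEnd, OverEnd, h3, h3', swaps]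
  · rcases fin4_cases i with rfl | rfl | rfl | rfl
    · rcases c0 with rfl | rfl | rfl | rfl <;>
        simp [octNbr, octPerm, outerEnd, OverEnd, h0, h0', swaps]
    · rcases c2 with rfl | rfl | rfl | rfl <;>
        simp [octNbr, octPerm, outerEnd, OverEnd, h2, h2', swaps]
    · rcases c2 with rfl | rfl | rfl | rfl <;>
        simp [octNbr, octPerm, outerEnd, OverEnd, h2, h2', swaps]
    · rcases c0 with rfl | rfl | rfl | rfl <;>
        simp [octNbr, octPerm, outerEnd, OverEnd, h0, h0', swaps]

theorem octPerm_sign (t : D.End) (v : Fin 4) : Equiv.Perm.sign (D.octPerm t v) = -1 := by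
  unfold octPerm
  split_ifs <;> decide

/-- The octahedral triangulation of the complement of the link and of two points. Its tetrahedra
are the pairs of a crossing and a corner. -/
abbrev octahedral : IdealTriangulation where
  Tet := D.Crossing × Fin 4
  fintypeTet := inferInstance
  nbr := D.octNbr
  perm := D.octPerm
  nbr_nbr t v := (D.octGlue t v).1
  perm_nbr t v := (D.octGlue t v).2.1
  facet_ne t v := (D.octGlue t v).2.2
  perm_odd := D.octPerm_sign

/-- The shape parameters, assigned to the horizontal edges: `z_b / z_a`, `z_c / z_b`, `z_d / z_c`
and `z_a / z_d` on the edges `AB`, `BC`, `CD` and `DA`. -/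
noncomputable def shape (z : D.Side → ℂ) (t : D.octahedral.Tet) : ℂ :=
  z (D.side (t.1, t.2 + 1)) / z (D.side (t.1, t.2))

/-- The vertex of the octahedron whose cusp runs along the strand with the end `j`: the vertex `F`
for the over-strand and the vertex `E` for the under-strand. -/
def strandVertex (j : Fin 4) : Fin 4 := if OverEnd j then 2 else 3

theorem strandVertex_spec (j : Fin 4) : ¬ (s(0, strandVertex j) : Sym2 (Fin 4)).IsDiag := by
  revert j; decide

/-- The edge of the octahedral triangulation that joins, in the octahedron `k`, the horizontal
vertex `H_j` to the vertex `F` if `j` is an over-end and to the vertex `E` if `j` is an under-end,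
where `d = (k, j)`. For a side from over to over, this is the edge `CF` of the octahedra at both
ends, and for a side from under to under, it is the edge `BE`. -/
def sideEdge (d : D.End) : D.octahedral.Edge :=
  Quot.mk _ (d, ⟨s(0, strandVertex d.2), strandVertex_spec d.2⟩)

/-- The permutation sending `0, 1, 2, 3` to `strandVertex j, 1, 0` and the fourth number. -/
def strandFrame (j : Fin 4) : Equiv.Perm (Fin 4) :=
  if OverEnd j then Equiv.swap 0 2 else Equiv.swap 2 3 * Equiv.swap 0 2

open CuspMove in
/-- The meridian around an alternating side. Let `d = (k, j)` be one of its ends and `d' = (k', j')`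
the other. The curve starts from the edge `H_j H_{j-1}` of the cusp cross-section in the octahedron
`k`, turns around `H_j` to `H_j H_{j+1}`, enters the octahedron `k'`, where it turns around `H_{j'}`
from `H_{j'} H_{j'-1}` to `H_{j'} H_{j'+1}`, and comes back across the other face of the side. -/
def meridianMoves : List CuspMove :=
  [turn, cross, turn, cross, flip, turn, cross, turn, flip, cross]

theorem meridian_closed (d : D.End) (hd : D.Alternating d) :
    D.octahedral.endpoint meridianMoves ((d.1, d.2 - 1), strandFrame d.2) =
      ((d.1, d.2 - 1), strandFrame d.2) := by
  obtain ⟨k, i⟩ := d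
  obtain ⟨k', j, c, h, h'⟩ := D.opp_cases k i
  rcases fin4_cases i with rfl | rfl | rfl | rfl <;> rcases c with rfl | rfl | rfl | rfl <;>
    simp [Alternating, OverEnd, h] at hd <;>
    simp [octahedral, meridianMoves, IdealTriangulation.endpoint, IdealTriangulation.step, octNbr,
      octPerm, outerEnd, OverEnd, strandFrame, Equiv.swap_apply_def, h, h', swaps]
  all_goals decide

/-- The meridian around the alternating side with end `d`, as a closed curve on the cusp. -/
def meridian (d : D.End) (hd : D.Alternating d) : D.octahedral.CuspLoop where
  base := ((d.1, d.2 - 1), strandFrame d.2)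
  moves := meridianMoves
  closed := D.meridian_closed d hd

/-- Follow the strand that enters a crossing through the end `d` to the end through which it enters
the next crossing. -/
def next (d : D.End) : D.End := D.opp (d.1, d.2 + 2)

instance (d : D.End) : Decidable (D.Alternating d) :=
  inferInstanceAs (Decidable (¬ (OverEnd d.2 ↔ OverEnd (D.opp d).2)))

open CuspMove in
/-- The curve on the cusp that runs along the right side of the strand entering a crossing through
the end `d = (k, j)`, from the edge `H_j H_{j+1}` of the cusp cross-section to the corresponding
edge at the next crossing. It passes through the links in the tetrahedra `(k, j)` and
`(k, j + 1)`. -/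
def passMoves (d : D.End) : List CuspMove :=
  [flip, turn, cross, turn, cross] ++ (if D.Alternating (d.1, d.2 + 2) then [] else [flip])

theorem pass_endpoint (d : D.End) :
    D.octahedral.endpoint (D.passMoves d) (d, strandFrame d.2 * Equiv.swap 1 2) =
      (D.next d, strandFrame (D.next d).2 * Equiv.swap 1 2) := by
  obtain ⟨k, i⟩ := d
  obtain ⟨k', j, c, h, h'⟩ := D.opp_cases k (i + 2)
  rcases fin4_cases i with rfl | rfl | rfl | rfl <;> rcases c with rfl | rfl | rfl | rfl <;>
    simp at h h' <;>
    simp [octahedral, passMoves, Alternating, next, IdealTriangulation.endpoint,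
      IdealTriangulation.step, octNbr, octPerm, outerEnd, OverEnd, strandFrame, Equiv.swap_apply_def, h]
  all_goals decide

/-- The longitude of the component of the link that enters a crossing through the end `d`: the
curve on the cusp that runs once along the component, on the right side of the strand. (Any other
longitude of this component differs from it by a multiple of the meridian.) -/
noncomputable def longitudeMoves (d : D.End) : List CuspMove :=
  (List.range (Function.minimalPeriod D.next d)).flatMap (fun m => D.passMoves (D.next^[m] d))

theorem longitude_endpoint (d : D.End) (n : ℕ) :
    D.octahedral.endpoint ((List.range n).flatMap (fun m => D.passMoves (D.next^[m] d)))
      (d, strandFrame d.2 * Equiv.swap 1 2) =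
      (D.next^[n] d, strandFrame (D.next^[n] d).2 * Equiv.swap 1 2) := by
  induction n with
  | zero => rfl
  | succ n ih =>
    rw [List.range_succ, List.flatMap_append, IdealTriangulation.endpoint_append, ih]
    simp only [List.flatMap_cons, List.flatMap_nil, List.append_nil]
    rw [Function.iterate_succ_apply']
    exact D.pass_endpoint _

/-- The longitude, as a closed curve on the cusp. -/
noncomputable def longitude (d : D.End) : D.octahedral.CuspLoop where
  base := (d, strandFrame d.2 * Equiv.swap 1 2)
  moves := D.longitudeMoves d
  closed := by
    have h := D.longitude_endpoint d (Function.minimalPeriod D.next d)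
    rw [Function.iterate_minimalPeriod] at h
    exact h

/-- The hyperbolicity equations of the octahedral triangulation, for the shape parameters given by
`z`: the gluing equations of all the edges, and the completeness conditions along all the meridians
and longitudes of the link. -/
def HyperbolicityEquations (z : D.Side → ℂ) : Prop :=
  (∀ e : D.octahedral.Edge, D.octahedral.GluingEquation (D.shape z) e) ∧
    (∀ (d : D.End) (hd : D.Alternating d), (D.meridian d hd).Complete (D.shape z)) ∧
    ∀ d : D.End, (D.longitude d).Complete (D.shape z)

end LinkDiagram

/-! Everything reduces to one number per end `d` of a side, `sideFactor z d`. Every branch `f` of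
the dilogarithm satisfies exp(-u f'(u)) = 1 - u, so exponentiating z_s ∂V/∂z_s removes the ambiguity
of the logarithm. The equation of the side with ends `d` and `opp d` becomes `sideFactor z d *
sideFactor z (opp d) = 1` (`potentialEquation_iff`).

Geometrically, `sideFactor z d` is, up to inversion, the angle (the product of two shape parameters)
of the octahedron at the edge from the horizontal vertex of `d` to the vertex E or F of its strand
(`sideAngle_eq`). The meridian of an alternating side turns about this point at both ends, so its
dilation is the product of the two factors (`meridian_holonomy`). At a non-alternating side the two
angles belong to a single edge, disjoint from all other octahedral edges by an explicit invariant
(`sideEdge_eq_iff`), and its gluing equation is the same condition (`edgeProduct_sideEdge`).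

For the other edges, the parameters at horizontal edges and at the central edges EF telescope,
because the shapes are quotients of side variables. The four angles at E, or at F, of an octahedron
multiply to 1. Moreover BF is glued to DF and AE to CE (`crossEdge_add_two`), which is where passing
both over and under enters. Hence the angles at these edges may be replaced by end factors
(`edgeProduct_eq`), which cancel in pairs under the equations of the sides (`edgeProduct_eq_one`).

For the longitude, the meridian translation is a diagonal of the quadrilateral in which the cusp
cuts an octahedron. Carried along the strand, this vector returns to itself
(`meridianVector_eq_iterate`); if it is nonzero, the longitude has dilation 1. It vanishes only if
the sides to the left and right of the strand carry equal variables, and then this holds along the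
whole component. For a knot all variables would be equal, against `Essential`. -/

/-! ### The derivative of the principal branch -/

open Complex in
theorem one_sub_mul_mem_slitPlane {u : ℂ} (hu : 1 - u ∈ slitPlane) {t : ℝ}
    (ht : t ∈ Set.Icc (0 : ℝ) 1) : 1 - (t : ℂ) * u ∈ slitPlane := by
  have h := starConvex_one_slitPlane hu (sub_nonneg.2 ht.2) ht.1 (by ring)
  convert h using 1
  simp only [real_smul, ofReal_sub, ofReal_one]
  ring

-- Differentiation under the integral sign gives u g = ∫₀¹ u / (1 - tu) dt, and the fundamental
-- theorem evaluates this integral. The product form covers u = 0.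
open Complex MeasureTheory Set Filter Topology in
theorem hasDerivAt_dilog {u : ℂ} (hu : 1 - u ∈ slitPlane) :
    ∃ g : ℂ, HasDerivAt dilog g u ∧ u * g = -log (1 - u) := by
  have hlog : ∀ w : ℂ, 1 - w ∈ slitPlane → ∀ t ∈ Icc (0 : ℝ) 1,
      HasDerivAt (fun s : ℝ => log (1 - (s : ℂ) * w)) (-w / (1 - (t : ℂ) * w)) t := by
    intro w hw t ht
    have h1 : HasDerivAt (fun s : ℝ => 1 - (s : ℂ) * w) (-w) t := by
      simpa using ((HasDerivAt.ofReal_comp (hasDerivAt_id t)).mul_const w).const_sub 1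
    exact h1.clog_real (one_sub_mul_mem_slitPlane hw ht)
  have hint : ∀ w : ℂ, 1 - w ∈ slitPlane →
      IntervalIntegrable (fun t : ℝ => log (1 - (t : ℂ) * w) / (t : ℂ)) volume 0 1 := by
    intro w hw
    -- The integrand is the difference quotient of s ↦ log(1 - sw) at 0, so its singularity at t = 0
    -- is removable.
    have hc : ContinuousOn (dslope (fun s : ℝ => log (1 - (s : ℂ) * w)) 0) (uIcc 0 1) := by
      rw [uIcc_of_le zero_le_one]
      intro t ht
      rcases eq_or_ne t 0 with rfl | h0
      · exact (continuousAt_dslope_same.2 (hlog w hw 0 ht).differentiableAt).continuousWithinAt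
      · exact ((continuousAt_dslope_of_ne h0).2
          (hlog w hw t ht).continuousAt).continuousWithinAt
    refine hc.intervalIntegrable.congr ?_
    rw [uIoc_of_le zero_le_one]
    intro t ht
    simp only [dslope_of_ne _ ht.1.ne', slope, real_smul, vsub_eq_sub]
    simp
    field_simp
  have hopen : IsOpen {w : ℂ | 1 - w ∈ slitPlane} :=
    isOpen_slitPlane.preimage (by fun_prop)
  obtain ⟨r, hr, hrV⟩ := Metric.nhds_basis_closedBall.mem_iff.1 (hopen.mem_nhds hu)
  -- The derivative of the integrand in w is jointly continuous on a compact set; this supplies a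
  -- constant dominating function.
  have hcont : ContinuousOn (fun p : ℂ × ℝ => -(1 - (p.2 : ℂ) * p.1)⁻¹)
      (Metric.closedBall u r ×ˢ Icc (0 : ℝ) 1) := by
    refine ContinuousOn.neg (ContinuousOn.inv₀ (by fun_prop) ?_)
    rintro ⟨w, t⟩ ⟨hw, ht⟩
    exact slitPlane_ne_zero (one_sub_mul_mem_slitPlane (hrV hw) ht)
  obtain ⟨C, hC⟩ :=
    ((isCompact_closedBall u r).prod isCompact_Icc).exists_bound_of_continuousOn hcont
  have hmeas : ContinuousOn (fun t : ℝ => -(1 - (t : ℂ) * u)⁻¹) (Icc 0 1) :=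
    hcont.comp (f := fun t : ℝ => (u, t)) (by fun_prop)
      (fun t ht => ⟨Metric.mem_closedBall_self hr.le, ht⟩)
  have key := intervalIntegral.hasDerivAt_integral_of_dominated_loc_of_deriv_le
    (μ := volume) (a := 0) (b := 1) (x₀ := u) (s := Metric.closedBall u r)
    (F := fun w (t : ℝ) => log (1 - (t : ℂ) * w) / (t : ℂ))
    (F' := fun w (t : ℝ) => -(1 - (t : ℂ) * w)⁻¹) (bound := fun _ => C)
    (Metric.closedBall_mem_nhds u hr)
    (by
      filter_upwards [hopen.mem_nhds hu] with w hw
      exact (intervalIntegrable_iff.1 (hint w hw)).aestronglyMeasurable)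
    (hint u hu)
    (by
      rw [uIoc_of_le zero_le_one]
      exact (hmeas.mono Ioc_subset_Icc_self).aestronglyMeasurable measurableSet_Ioc)
    (Eventually.of_forall (by
      intro t ht w hw
      rw [uIoc_of_le zero_le_one] at ht
      exact hC (w, t) ⟨hw, Ioc_subset_Icc_self ht⟩))
    intervalIntegrable_const
    (Eventually.of_forall (by
      intro t ht w hw
      rw [uIoc_of_le zero_le_one] at ht
      have h1 : HasDerivAt (fun w : ℂ => 1 - (t : ℂ) * w) (-(t : ℂ)) w := by
        simpa using ((hasDerivAt_id w).const_mul (t : ℂ)).const_sub 1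
      have h2 := (h1.clog (one_sub_mul_mem_slitPlane (hrV hw) (Ioc_subset_Icc_self ht))).div_const
        (t : ℂ)
      refine h2.congr_deriv ?_
      rw [div_right_comm, neg_div, div_self (ofReal_ne_zero.2 ht.1.ne'), neg_div, one_div]))
  refine ⟨_, key.2.neg, ?_⟩
  have hftc := intervalIntegral.integral_eq_sub_of_hasDerivAt
    (f := fun s : ℝ => log (1 - (s : ℂ) * u)) (f' := fun t : ℝ => -u / (1 - (t : ℂ) * u))
    (a := 0) (b := 1)
    (fun t ht => hlog u hu t (by rwa [uIcc_of_le zero_le_one] at ht))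
    (by
      apply ContinuousOn.intervalIntegrable
      rw [uIcc_of_le zero_le_one]
      refine (hmeas.const_smul u).congr fun t _ => ?_
      simp [div_eq_mul_inv])
  simp only [ofReal_one, one_mul, ofReal_zero, zero_mul, sub_zero, log_one] at hftc
  rw [← hftc, ← intervalIntegral.integral_neg, ← intervalIntegral.integral_neg,
    ← intervalIntegral.integral_const_mul]
  congr 1
  ext t
  simp [div_eq_mul_inv]

open Complex in
theorem hasDerivAt_dilog_of_ne_zero {u : ℂ} (hu : 1 - u ∈ slitPlane) (h0 : u ≠ 0) :
    HasDerivAt dilog (-log (1 - u) / u) u := by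
  obtain ⟨g, hg, h⟩ := hasDerivAt_dilog hu
  rwa [← h, mul_div_cancel_left₀ _ h0]

open Complex Filter Topology in
theorem analyticAt_dilog {u : ℂ} (hu : 1 - u ∈ slitPlane) : AnalyticAt ℂ dilog u := by
  rw [analyticAt_iff_eventually_differentiableAt]
  filter_upwards [(isOpen_slitPlane.preimage (by fun_prop : Continuous fun w : ℂ => 1 - w)).mem_nhds
    hu] with w hw
  exact (hasDerivAt_dilog hw).choose_spec.1.differentiableAt

/-! ### Branches of the dilogarithm -/

/-- The differential equation `exp (-u f'(u)) = 1 - u` satisfied by the branches of the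
dilogarithm. -/
def IsDilogDeriv (f : ℂ → ℂ) (w : ℂ) : Prop :=
  Complex.exp (-(w * deriv f w)) = 1 - w

open Filter Topology in
theorem isDilogDeriv_congr {f g : ℂ → ℂ} {u : ℂ} (h : f =ᶠ[𝓝 u] g)
    (hf : ∀ᶠ w in 𝓝 u, IsDilogDeriv f w) : ∀ᶠ w in 𝓝 u, IsDilogDeriv g w := by
  filter_upwards [h.deriv, hf] with w h1 h2
  rwa [IsDilogDeriv, ← h1]

-- Identity theorem, both sides of the differential equation being analytic on `s`.
open Filter Topology in
theorem eventually_isDilogDeriv_iff {f : ℂ → ℂ} {s : Set ℂ} (hf : AnalyticOnNhd ℂ f s)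
    (hs : IsPreconnected s) {u v : ℂ} (hu : u ∈ s) (hv : v ∈ s)
    (h : ∀ᶠ w in 𝓝 u, IsDilogDeriv f w) : IsDilogDeriv f v := by
  have h1 : AnalyticOnNhd ℂ (fun w => Complex.exp (-(w * deriv f w))) s := fun w hw =>
    (analyticAt_id.mul (hf w hw).deriv).neg.cexp
  have h2 : AnalyticOnNhd ℂ (fun w : ℂ => 1 - w) s := fun w _ => analyticAt_const.sub analyticAt_id
  exact h1.eqOn_of_preconnected_of_eventuallyEq h2 hs hu h hv

open Filter Topology in
theorem IsDilogBranch.analyticAt {f : ℂ → ℂ} {u : ℂ} (h : IsDilogBranch f u) :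
    AnalyticAt ℂ f u := by
  obtain ⟨γ, F, -, hF, -, -, hf⟩ := h
  have := hF 1
  rw [γ.target] at this
  exact this.congr hf.symm

-- The equation holds for the principal branch near 1/2 and is propagated along the path by the
-- identity theorem: the times at which it holds form a clopen subset of the unit interval.
open Filter Topology in
theorem IsDilogBranch.isDilogDeriv {f : ℂ → ℂ} {u : ℂ} (h : IsDilogBranch f u) :
    IsDilogDeriv f u := by
  obtain ⟨γ, F, hγ, hF, hloc, hF0, hf⟩ := h
  let S : Set unitInterval := {t | ∀ᶠ w in 𝓝 (γ t), IsDilogDeriv (F t) w}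
  have hiff : ∀ t, ∀ᶠ s in 𝓝 t, s ∈ S ↔ t ∈ S := by
    intro t
    obtain ⟨r, hr, hball⟩ := Metric.eventually_nhds_iff_ball.1 (hF t).eventually_analyticAt
    filter_upwards [hloc t, γ.continuous.continuousAt.preimage_mem_nhds
      (Metric.ball_mem_nhds _ hr)] with s h1 hs
    have hpre := (convex_ball (γ t) r).isPreconnected
    constructor
    · intro h
      filter_upwards [Metric.ball_mem_nhds (γ t) hr] with w hw
      exact eventually_isDilogDeriv_iff hball hpre hs hw (isDilogDeriv_congr h1 h)
    · intro h
      refine isDilogDeriv_congr h1.symm ?_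
      filter_upwards [Metric.isOpen_ball.mem_nhds hs] with w hw
      exact eventually_isDilogDeriv_iff hball hpre (Metric.mem_ball_self hr) hw h
  have hclopen : IsClopen S := by
    constructor
    · rw [← isOpen_compl_iff, isOpen_iff_mem_nhds]
      intro t ht
      filter_upwards [hiff t] with s hs
      exact fun h => ht (hs.1 h)
    · rw [isOpen_iff_mem_nhds]
      intro t ht
      filter_upwards [hiff t] with s hs
      exact hs.2 ht
  have h0 : (0 : unitInterval) ∈ S := by
    show ∀ᶠ w in 𝓝 (γ 0), IsDilogDeriv (F 0) w
    rw [γ.source]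
    refine isDilogDeriv_congr hF0.symm ?_
    filter_upwards [Metric.ball_mem_nhds (1 / 2 : ℂ) (show (0 : ℝ) < 1 / 2 by norm_num)] with w hw
    have h1 : 1 - w ∈ Complex.slitPlane := by
      left
      have := (Complex.abs_re_le_norm _).trans_lt (mem_ball_iff_norm.1 hw)
      rw [abs_lt] at this
      simp at this ⊢
      linarith
    have hw0 : w ≠ 0 := by
      rintro rfl
      simp at hw
    rw [IsDilogDeriv, (hasDerivAt_dilog_of_ne_zero h1 hw0).deriv, mul_div_cancel₀ _ hw0, neg_neg,
      Complex.exp_log (Complex.slitPlane_ne_zero h1)]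
  have h1 : (1 : unitInterval) ∈ S := by
    rw [hclopen.eq_univ ⟨0, h0⟩]
    trivial
  have h2 : ∀ᶠ w in 𝓝 (γ 1), IsDilogDeriv (F 1) w := h1
  rw [γ.target] at h2
  exact (isDilogDeriv_congr hf.symm h2).self_of_nhds

-- A single function analytic along the whole path is its own continuation.
open Filter Topology in
theorem isDilogBranch_of_joinedIn {f : ℂ → ℂ} {u : ℂ} {s : Set ℂ} (hs : JoinedIn s (1 / 2) u)
    (hne : ∀ w ∈ s, w ≠ 0 ∧ w ≠ 1) (hf : ∀ w ∈ s, AnalyticAt ℂ f w)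
    (h : f =ᶠ[𝓝 (1 / 2 : ℂ)] dilog) : IsDilogBranch f u := by
  obtain ⟨γ, hγ⟩ := hs
  exact ⟨γ, fun _ => f, fun t => hne _ (hγ t), fun t => hf _ (hγ t),
    fun t => Eventually.of_forall fun s => EventuallyEq.rfl, h, EventuallyEq.rfl⟩

open Complex in
theorem isDilogBranch_dilog {u : ℂ} (hu : 1 - u ∈ slitPlane) (h0 : u ≠ 0) :
    IsDilogBranch dilog u := by
  have hjoin : ∀ c v : ℂ, c.im ≠ 0 → 0 ≤ c.im * v.im → 1 - v ∈ slitPlane → v ≠ 0 →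
      JoinedIn {w : ℂ | 1 - w ∈ slitPlane ∧ w ≠ 0} c v := by
    intro c v hc hcv hv hv0
    refine JoinedIn.of_segment_subset ?_
    rintro w ⟨a, b, ha, hb, hab, rfl⟩
    rcases ha.eq_or_lt with rfl | ha
    · obtain rfl : b = 1 := by linarith
      simpa using ⟨hv, hv0⟩
    · have him : (a • c + b • v).im ≠ 0 := by
        intro h
        simp only [add_im, smul_im, smul_eq_mul] at h
        have h1 : a * (c.im * c.im) + b * (c.im * v.im) = 0 := by linear_combination c.im * h
        have h2 : 0 < a * (c.im * c.im) := mul_pos ha (mul_self_pos.2 hc)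
        have h3 := mul_nonneg hb hcv
        linarith
      refine ⟨Or.inr (by rw [sub_im, one_im, zero_sub]; exact neg_ne_zero.2 him),
        fun h => him (by rw [h, zero_im])⟩
  -- The path goes through ±i, on the side of u. Segments from there stay in an open half-plane up
  -- to their endpoints, avoiding 0 and the cut.
  obtain ⟨c, hc, hcu⟩ : ∃ c : ℂ, c.im ≠ 0 ∧ 0 ≤ c.im * u.im := by
    rcases le_total 0 u.im with h | h
    · exact ⟨I, by simp, by simpa using h⟩
    · exact ⟨-I, by simp, by simpa using h⟩
  refine isDilogBranch_of_joinedIn ((hjoin c (1 / 2) hc (by simp) (Or.inl (by norm_num))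
    (by norm_num)).symm.trans (hjoin c u hc hcu hu h0)) ?_ (fun w hw => analyticAt_dilog hw.1)
    Filter.EventuallyEq.rfl
  rintro w ⟨hw, hw0⟩
  refine ⟨hw0, ?_⟩
  rintro rfl
  simp at hw

open Complex Filter Topology in
/-- Beyond the branch point `1`, a branch of the dilogarithm is obtained from Euler's reflection
formula. -/
theorem exists_isDilogBranch_of_one_lt {u : ℂ} (hu : 1 < u.re) (him : 0 ≤ u.im) :
    ∃ f, IsDilogBranch f u := by
  -- The cut of log(1 - w) is turned so as to run from 1 vertically downwards; thus V contains the
  -- real numbers greater than 1.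
  let V : Set ℂ := {w | 0 < w.re ∧ I * (1 - w) ∈ slitPlane}
  have hVne : ∀ w ∈ V, w ≠ 0 ∧ w ≠ 1 := by
    rintro w ⟨h1, h2⟩
    constructor
    · rintro rfl
      simp at h1
    · rintro rfl
      simp at h2
  -- `ℓ` is log(1 - w) with the turned cut. `G` is the reflection formula without its constant, and
  -- its derivative is -`ℓ` w / w.
  let ℓ : ℂ → ℂ := fun w => log (I * (1 - w)) - Real.pi / 2 * I
  let G : ℂ → ℂ := fun w => -dilog (1 - w) - log w * ℓ w
  have hG : ∀ w ∈ V, HasDerivAt G (-ℓ w / w) w := by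
    rintro w ⟨h1, h2⟩
    obtain ⟨hw0, hw1⟩ := hVne w ⟨h1, h2⟩
    have hw : w ∈ slitPlane := Or.inl h1
    have h1w : 1 - w ≠ 0 := sub_ne_zero.2 hw1.symm
    have hd1 : HasDerivAt (fun w : ℂ => 1 - w) (-1) w := by
      simpa using (hasDerivAt_id w).const_sub 1
    have hd2 := HasDerivAt.comp w
      (hasDerivAt_dilog_of_ne_zero (u := 1 - w) (by simpa using hw) h1w) hd1
    have hd3 := ((hd1.const_mul I).clog h2).sub_const (Real.pi / 2 * I)
    have hd4 := hd2.neg.sub ((hasDerivAt_log hw).mul hd3)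
    refine hd4.congr_deriv ?_
    simp only [sub_sub_cancel]
    field_simp
    simp only [ℓ]
    ring_nf
  have hVopen : IsOpen V :=
    (isOpen_lt continuous_const continuous_re).inter
      (isOpen_slitPlane.preimage (by fun_prop : Continuous fun w : ℂ => I * (1 - w)))
  have hGan : ∀ w ∈ V, AnalyticAt ℂ G w := by
    intro w hw
    rw [analyticAt_iff_eventually_differentiableAt]
    filter_upwards [hVopen.mem_nhds hw] with v hv
    exact (hG v hv).differentiableAt
  have hjoin : ∀ v : ℂ, 0 < v.re → v.re ≠ 1 → 0 ≤ v.im → JoinedIn V (1 + I) v := by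
    intro v hv1 hv2 hv3
    refine JoinedIn.of_segment_subset ?_
    rintro w ⟨a, b, ha, hb, hab, rfl⟩
    rcases ha.eq_or_lt with rfl | ha
    · obtain rfl : b = 1 := by linarith
      refine ⟨by simpa using hv1, Or.inr ?_⟩
      simpa [sub_eq_zero] using hv2.symm
    · refine ⟨?_, Or.inl ?_⟩
      · have := mul_nonneg hb hv1.le
        simp
        linarith
      · have := mul_nonneg hb hv3
        simp
        linarith
  let r : ℝ := 1 / 2
  have hball : ∀ w ∈ Metric.ball (1 / 2 : ℂ) r, 0 < w.re ∧ w.re < 1 := by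
    intro w hw
    have := (Complex.abs_re_le_norm _).trans_lt (mem_ball_iff_norm.1 hw)
    rw [abs_lt] at this
    simp [r] at this ⊢
    constructor <;> linarith
  have hballV : ∀ w ∈ Metric.ball (1 / 2 : ℂ) r, w ∈ V := fun w hw =>
    ⟨(hball w hw).1, Or.inr (by simpa [sub_eq_zero] using (hball w hw).2.ne')⟩
  have hhalf : (1 / 2 : ℂ) ∈ Metric.ball (1 / 2 : ℂ) r := Metric.mem_ball_self (by norm_num [r])
  have hℓ : ∀ w ∈ Metric.ball (1 / 2 : ℂ) r, ℓ w = log (1 - w) := by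
    intro w hw
    have hre : 0 < (1 - w).re := by simpa using (hball w hw).2
    have harg := abs_lt.1 (abs_arg_lt_pi_div_two_iff.2 (Or.inl hre))
    have hpi := Real.pi_pos
    simp only [ℓ]
    rw [log_mul I_ne_zero (fun h => by simp [h] at hre), log_I]
    · ring
    · rw [arg_I]
      constructor <;> linarith [harg.1, harg.2]
  -- Near 1/2 both sides have the derivative -log(1 - w) / w, so a constant corrects `G` to the
  -- principal branch.
  have heq : Set.EqOn dilog (fun w => G w + (dilog (1 / 2) - G (1 / 2)))
      (Metric.ball (1 / 2 : ℂ) r) := by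
    have hslit : ∀ w ∈ Metric.ball (1 / 2 : ℂ) r, 1 - w ∈ slitPlane := fun w hw =>
      Or.inl (by simpa using (hball w hw).2)
    refine Metric.isOpen_ball.eqOn_of_deriv_eq (convex_ball _ _).isPreconnected
      (fun w hw => (hasDerivAt_dilog
        (hslit w hw)).choose_spec.1.differentiableAt.differentiableWithinAt)
      (fun w hw => ((hG w (hballV w hw)).add_const _).differentiableAt.differentiableWithinAt)
      (fun w hw => ?_) hhalf (by simp)
    rw [(hasDerivAt_dilog_of_ne_zero (hslit w hw) (hVne w (hballV w hw)).1).deriv,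
      ((hG w (hballV w hw)).add_const _).deriv, hℓ w hw]
  exact ⟨_, isDilogBranch_of_joinedIn
    ((hjoin (1 / 2) (by norm_num) (by norm_num) (by simp)).symm.trans
      (hjoin u (by linarith) hu.ne' him)) hVne
    (fun w hw => (hGan w hw).add analyticAt_const)
    (heq.eventuallyEq_of_mem (Metric.isOpen_ball.mem_nhds hhalf)).symm⟩

theorem exists_isDilogBranch {u : ℂ} (h0 : u ≠ 0) (h1 : u ≠ 1) : ∃ f, IsDilogBranch f u := by
  by_cases h : 1 - u ∈ Complex.slitPlane
  · exact ⟨dilog, isDilogBranch_dilog h h0⟩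
  · rw [Complex.mem_slitPlane_iff, not_or, not_lt, not_not] at h
    have him : u.im = 0 := by simpa using h.2
    refine exists_isDilogBranch_of_one_lt (lt_of_le_of_ne (by simpa using h.1) ?_) him.ge
    intro h2
    exact h1 (Complex.ext h2.symm (by simpa using him))

/-! ### The equations of the sides as products of end factors -/

namespace LinkDiagram

variable (D : LinkDiagram)

/-- The contribution of the end `d` of a side to the equation of the side. -/
noncomputable def sideFactor (z : D.Side → ℂ) (d : D.End) : ℂ :=
  (1 - D.cornerRatio z d.1 d.2) / (1 - D.cornerRatio z d.1 (d.2 - 1))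

theorem side_opp (d : D.End) : D.side (D.opp d) = D.side d :=
  Quotient.sound (Or.inr (D.opp_opp d).symm)

theorem side_eq_iff (d d' : D.End) : D.side d' = D.side d ↔ d' = d ∨ d' = D.opp d := by
  refine Quotient.eq.trans ?_
  constructor
  · rintro (h | h)
    · exact Or.inl h.symm
    · exact Or.inr (by rw [h, D.opp_opp])
  · rintro (h | h)
    · exact Or.inl h.symm
    · exact Or.inr (by rw [h, D.opp_opp])

open Classical in
/-- The derivative of the side variable of an end with respect to the variable of the side `s`. -/
noncomputable def sideDelta (s : D.Side) (d : D.End) : ℂ := if D.side d = s then 1 else 0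

variable {D}

open Classical in
theorem hasDerivAt_update_div (z : D.Side → ℂ) (s : D.Side) (d d' : D.End)
    (hd' : z (D.side d') ≠ 0) :
    ∃ g, HasDerivAt (fun w => Function.update z s w (D.side d) / Function.update z s w (D.side d'))
        g (z s) ∧
      z s * g = z (D.side d) / z (D.side d') * (D.sideDelta s d - D.sideDelta s d') := by
  have h : ∀ d : D.End, HasDerivAt (fun w => Function.update z s w (D.side d))
      (D.sideDelta s d) (z s) := by
    intro d
    unfold sideDelta
    split_ifs with h
    · subst h
      simpa using hasDerivAt_id' _
    · simpa [Function.update_of_ne h] using hasDerivAt_const (z s) _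
  have hδ : ∀ d : D.End, z s * D.sideDelta s d = z (D.side d) * D.sideDelta s d := by
    intro d
    unfold sideDelta
    split_ifs with h
    · rw [h]
    · simp
  refine ⟨_, (h d).div (h d') (by simpa using hd'), ?_⟩
  simp only [Function.update_eq_self]
  field_simp
  linear_combination z (D.side d') * hδ d - z (D.side d) * hδ d'

/-- The numerator of the ratio at a corner. -/
def cornerNum : Fin 4 → Fin 4 := ![1, 1, 3, 3]

/-- The denominator of the ratio at a corner. -/
def cornerDen : Fin 4 → Fin 4 := ![0, 2, 2, 0]

theorem cornerRatio_eq (z : D.Side → ℂ) (k : D.Crossing) (i : Fin 4) :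
    D.cornerRatio z k i = z (D.side (k, cornerNum i)) / z (D.side (k, cornerDen i)) := by
  fin_cases i <;> rfl

theorem cornerRatio_ne_zero {z : D.Side → ℂ} (hz : D.Essential z) (k : D.Crossing) (i : Fin 4) :
    D.cornerRatio z k i ≠ 0 := by
  rw [cornerRatio_eq]
  exact div_ne_zero (hz.1 _) (hz.1 _)

theorem exists_isBranchAt {z : D.Side → ℂ} (hz : D.Essential z) : ∃ f, D.IsBranchAt f z := by
  choose f hf using fun k i => exists_isDilogBranch (cornerRatio_ne_zero hz k i) (hz.2 k i)
  exact ⟨f, hf⟩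

theorem sideFactor_ne_zero {z : D.Side → ℂ} (hz : D.Essential z) (d : D.End) :
    D.sideFactor z d ≠ 0 :=
  div_ne_zero (sub_ne_zero.2 (hz.2 _ _).symm) (sub_ne_zero.2 (hz.2 _ _).symm)

open Classical in
theorem hasDerivAt_branch {z : D.Side → ℂ} (hz : D.Essential z) {f : D.Crossing → Fin 4 → ℂ → ℂ}
    (hf : D.IsBranchAt f z) (s : D.Side) (k : D.Crossing) (i : Fin 4) :
    ∃ g, HasDerivAt (fun w => f k i (D.cornerRatio (Function.update z s w) k i)) g (z s) ∧
      z s * g = D.cornerRatio z k i * deriv (f k i) (D.cornerRatio z k i) *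
        (D.sideDelta s (k, cornerNum i) - D.sideDelta s (k, cornerDen i)) := by
  obtain ⟨g, hg, h⟩ := hasDerivAt_update_div z s (k, cornerNum i) (k, cornerDen i) (hz.1 _)
  simp only [← cornerRatio_eq] at hg h
  have h1 := (hf k i).analyticAt.differentiableAt.hasDerivAt
  have h2 : D.cornerRatio z k i = D.cornerRatio (Function.update z s (z s)) k i := by
    rw [Function.update_eq_self]
  refine ⟨_, HasDerivAt.comp (z s) (h₂ := f k i) (h2 ▸ h1) hg, ?_⟩
  simp only [Function.update_eq_self]
  linear_combination deriv (f k i) (D.cornerRatio z k i) * h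

-- The end j borders only the corners j - 1 and j; it is the numerator at both if it is an
-- under-end, the denominator at both if it is an over-end. With the alternating signs of V, both
-- kinds contribute the same expression, so the sum over corners becomes a sum over ends.
open Classical in
theorem deriv_potential {z : D.Side → ℂ} (hz : D.Essential z) {f : D.Crossing → Fin 4 → ℂ → ℂ}
    (hf : D.IsBranchAt f z) (s : D.Side) :
    z s * deriv (fun w => D.potential f (Function.update z s w)) (z s) =
      ∑ d : D.End, D.sideDelta s d *
        (D.cornerRatio z d.1 (d.2 - 1) * deriv (f d.1 (d.2 - 1)) (D.cornerRatio z d.1 (d.2 - 1)) -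
          D.cornerRatio z d.1 d.2 * deriv (f d.1 d.2) (D.cornerRatio z d.1 d.2)) := by
  choose g hg h using hasDerivAt_branch hz hf s
  have h1 : HasDerivAt (fun w => D.potential f (Function.update z s w))
      (∑ k, (g k 0 - g k 1 + g k 2 - g k 3)) (z s) := by
    unfold potential
    exact HasDerivAt.fun_sum fun k _ =>
      (((hg k 0).sub (hg k 1)).add (hg k 2)).sub (hg k 3)
  rw [h1.deriv, Finset.mul_sum, Fintype.sum_prod_type]
  refine Finset.sum_congr rfl fun k _ => ?_
  rw [Fin.sum_univ_four]
  have e : (0 - 1 : Fin 4) = 3 ∧ (1 - 1 : Fin 4) = 0 ∧ (2 - 1 : Fin 4) = 1 ∧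
    (3 - 1 : Fin 4) = 2 := by decide
  simp only [e.1, e.2.1, e.2.2.1, e.2.2.2]
  have e0 := h k 0
  have e1 := h k 1
  have e2 := h k 2
  have e3 := h k 3
  simp only [show cornerNum 0 = 1 from rfl, show cornerNum 1 = 1 from rfl,
    show cornerNum 2 = 3 from rfl, show cornerNum 3 = 3 from rfl,
    show cornerDen 0 = 0 from rfl, show cornerDen 1 = 2 from rfl,
    show cornerDen 2 = 2 from rfl, show cornerDen 3 = 0 from rfl] at e0 e1 e2 e3
  linear_combination e0 - e1 + e2 - e3

theorem potentialEquation_iff {z : D.Side → ℂ} (hz : D.Essential z)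
    {f : D.Crossing → Fin 4 → ℂ → ℂ} (hf : D.IsBranchAt f z) (d : D.End) :
    D.PotentialEquation f z (D.side d) ↔ D.sideFactor z d * D.sideFactor z (D.opp d) = 1 := by
  classical
  have hexp : ∀ d : D.End, Complex.exp
      (D.cornerRatio z d.1 (d.2 - 1) * deriv (f d.1 (d.2 - 1)) (D.cornerRatio z d.1 (d.2 - 1)) -
        D.cornerRatio z d.1 d.2 * deriv (f d.1 d.2) (D.cornerRatio z d.1 d.2)) =
      D.sideFactor z d := by
    intro d
    have h1 := (hf d.1 d.2).isDilogDeriv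
    have h2 := (hf d.1 (d.2 - 1)).isDilogDeriv
    rw [IsDilogDeriv] at h1 h2
    rw [sideFactor, ← h1, ← h2, ← Complex.exp_sub]
    congr 1
    ring
  have hδ : ∀ d' : D.End, D.sideDelta (D.side d) d' =
      if d' ∈ ({d, D.opp d} : Finset D.End) then 1 else 0 := by
    intro d'
    unfold sideDelta
    simp only [side_eq_iff, Finset.mem_insert, Finset.mem_singleton]
  unfold PotentialEquation
  convert Iff.rfl using 2
  rw [← hexp, ← hexp, ← Complex.exp_add]
  congr 1
  symm
  convert deriv_potential hz hf (D.side d) using 1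
  -- Only the two ends of the side survive. They are distinct even if both lie at one crossing, so
  -- neither is counted twice.
  simp only [hδ, ite_mul, one_mul, zero_mul]
  rw [Finset.sum_ite_mem, Finset.univ_inter, Finset.sum_pair (D.opp_ne d).symm]

end LinkDiagram

/-! ### Products over classes -/

/-- Telescoping: `φ` permutes each class of `c`, so numerators and denominators run over the same
values. -/
theorem prod_ite_div_eq_one {α β : Type*} [Fintype α] [DecidableEq β] (φ : α ≃ α) (c : α → β)
    (hc : ∀ t, c (φ t) = c t) (e : β) (g : α → ℂ) (hg : ∀ t, g t ≠ 0) :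
    ∏ t, (if c t = e then g (φ t) / g t else 1) = 1 := by
  have h1 : ∀ t, (if c t = e then g (φ t) / g t else 1) =
      (if c (φ t) = e then g (φ t) else 1) / (if c t = e then g t else 1) := by
    intro t
    rw [hc]
    split_ifs <;> simp
  rw [Finset.prod_congr rfl fun t _ => h1 t, Finset.prod_div_distrib,
    Equiv.prod_comp φ (fun t => if c t = e then g t else 1), div_self]
  refine Finset.prod_ne_zero_iff.2 fun t _ => ?_
  split_ifs
  exacts [hg t, one_ne_zero]

theorem prod_eq_one_of_involution {α : Type*} [Fintype α] (ρ : α → α) (hρ : ∀ t, ρ (ρ t) = t)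
    (hne : ∀ t, ρ t ≠ t) (f : α → ℂ) (hf : ∀ t, f t * f (ρ t) = 1) : ∏ t, f t = 1 :=
  Finset.prod_involution (fun t _ => ρ t) (fun t _ => hf t) (fun t _ _ => hne t)
    (fun _ _ => Finset.mem_univ _) (fun t _ => hρ t)

/-- The grouping separates the horizontal and central edges, whose parameters telescope, from the
edges to F and the edges to E. -/
theorem prod_tetEdge {M : Type*} [CommMonoid M] (f : {e : Sym2 (Fin 4) // ¬ e.IsDiag} → M) :
    ∏ e, f e = f ⟨s(0, 1), by decide⟩ * f ⟨s(2, 3), by decide⟩ *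
      ((f ⟨s(0, 2), by decide⟩ * f ⟨s(1, 2), by decide⟩) *
        (f ⟨s(0, 3), by decide⟩ * f ⟨s(1, 3), by decide⟩)) := by
  have h : (Finset.univ : Finset {e : Sym2 (Fin 4) // ¬ e.IsDiag}) =
      {⟨s(0, 1), by decide⟩, ⟨s(2, 3), by decide⟩, ⟨s(0, 2), by decide⟩, ⟨s(1, 2), by decide⟩,
        ⟨s(0, 3), by decide⟩, ⟨s(1, 3), by decide⟩} := by decide
  rw [h, Finset.prod_insert (by decide), Finset.prod_insert (by decide),
    Finset.prod_insert (by decide), Finset.prod_insert (by decide), Finset.prod_insert (by decide),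
    Finset.prod_singleton]
  simp only [mul_assoc]

namespace LinkDiagram

variable (D : LinkDiagram)

/-! ### Identifications of edges -/

/-- The class of an edge of a tetrahedron of the octahedral triangulation. -/
def edgeClass (t : D.End) (e : Sym2 (Fin 4)) (h : ¬ e.IsDiag) : D.octahedral.Edge :=
  Quot.mk _ (t, ⟨e, h⟩)

theorem edgeClass_eq {t t' : D.End} {e e' : Sym2 (Fin 4)} (h : ¬ e.IsDiag) (h' : ¬ e'.IsDiag)
    (v : Fin 4) (hv : v ∉ e) (ht : D.octNbr t v = t') (he : Sym2.map (D.octPerm t v) e = e') :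
    D.edgeClass t e h = D.edgeClass t' e' h' :=
  Quot.sound ⟨v, hv, ht.symm, he.symm⟩

/-- The vertex of the octahedron that does not lie on the two outer facets glued along a side. -/
def oppositeVertex (j : Fin 4) : Fin 4 := if OverEnd j then 3 else 2

theorem outerEnd_left (j : Fin 4) : outerEnd j (oppositeVertex j) = j := by
  revert j; decide

theorem outerEnd_right (j : Fin 4) : outerEnd (j - 1) (oppositeVertex j) = j := by
  revert j; decide

theorem oppositeVertex_ne (j : Fin 4) : oppositeVertex j ≠ 0 ∧ oppositeVertex j ≠ 1 := by
  revert j; decide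

theorem octNbr_left (d : D.End) :
    D.octNbr d (oppositeVertex d.2) = ((D.opp d).1, (D.opp d).2 - 1) := by
  have h := oppositeVertex_ne d.2
  simp [octNbr, h.1, h.2, outerEnd_left]

theorem octNbr_right (d : D.End) :
    D.octNbr (d.1, d.2 - 1) (oppositeVertex d.2) = D.opp d := by
  have h := oppositeVertex_ne d.2
  have h1 : d.2 ≠ d.2 - 1 := by
    generalize d.2 = j
    revert j; decide
  simp [octNbr, h.1, h.2, outerEnd_right, h1]

theorem octPerm_left (d : D.End) :
    D.octPerm d (oppositeVertex d.2) =
      if D.Alternating d then Equiv.swap 2 3 else Equiv.swap 0 1 := by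
  have h := oppositeVertex_ne d.2
  simp only [octPerm, h.1, h.2, or_self, if_false, outerEnd_left]
  by_cases hd : D.Alternating d
  · rw [if_pos hd, if_neg hd]
  · rw [if_neg hd, if_pos (not_not.1 hd)]

theorem octPerm_right (d : D.End) :
    D.octPerm (d.1, d.2 - 1) (oppositeVertex d.2) =
      if D.Alternating d then Equiv.swap 2 3 else Equiv.swap 0 1 := by
  have h := oppositeVertex_ne d.2
  simp only [octPerm, h.1, h.2, or_self, if_false, outerEnd_right]
  by_cases hd : D.Alternating d
  · rw [if_pos hd, if_neg hd]
  · rw [if_neg hd, if_pos (not_not.1 hd)]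

variable {D}

theorem alternating_opp {d : D.End} : D.Alternating (D.opp d) ↔ D.Alternating d := by
  simp only [Alternating, D.opp_opp]
  tauto

theorem strandVertex_opp {d : D.End} (hd : ¬ D.Alternating d) :
    strandVertex (D.opp d).2 = strandVertex d.2 := by
  simp only [Alternating, not_not] at hd
  simp only [strandVertex, hd]

theorem strandVertex_opp_of_alternating {d : D.End} (hd : D.Alternating d) :
    strandVertex (D.opp d).2 = oppositeVertex d.2 := by
  simp only [Alternating] at hd
  simp only [strandVertex, oppositeVertex]
  split_ifs <;> tauto

theorem strandVertex_mem (j : Fin 4) : strandVertex j = 2 ∧ oppositeVertex j = 3 ∨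
    strandVertex j = 3 ∧ oppositeVertex j = 2 := by
  revert j; decide

theorem isDiag_zero (j : Fin 4) : ¬ (s(0, strandVertex j) : Sym2 (Fin 4)).IsDiag := by
  revert j; decide

theorem isDiag_one (j : Fin 4) : ¬ (s(1, strandVertex j) : Sym2 (Fin 4)).IsDiag := by
  revert j; decide

variable (D) in
/-- The class of the edge from the vertex of the strand through the end `d` to the next horizontal
vertex after `d`. -/
def crossEdge (d : D.End) : D.octahedral.Edge :=
  D.edgeClass d s(1, strandVertex d.2) (isDiag_one d.2)

theorem edgeClass_inner (t : D.End) (X : Fin 4) (h : ¬ (s(1, X) : Sym2 (Fin 4)).IsDiag)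
    (h' : ¬ (s(0, X) : Sym2 (Fin 4)).IsDiag) (hX : X ≠ 1) :
    D.edgeClass t s(1, X) h = D.edgeClass (t.1, t.2 + 1) s(0, X) h' := by
  have hX0 : X ≠ 0 := fun hX => h' (by simp [hX])
  refine D.edgeClass_eq h h' 0 (by simp [hX0.symm]) (by simp [octNbr]) ?_
  simp [octPerm, Equiv.swap_apply_of_ne_of_ne hX0 hX]

/-- Horizontal edges are glued successively around a region of the diagram; this is the permutation
along which their parameters telescope. -/
theorem edgeClass_zero_one (d : D.End) :
    D.edgeClass (D.opp d) s(0, 1) (by decide) =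
      D.edgeClass (d.1, d.2 - 1) s(0, 1) (by decide) := by
  refine (D.edgeClass_eq _ _ (oppositeVertex d.2) ?_ (D.octNbr_right d) ?_).symm
  · simpa using oppositeVertex_ne d.2
  · rw [octPerm_right]
    split_ifs <;> decide

theorem edgeClass_two_three (t : D.End) :
    D.edgeClass (t.1, t.2 + 1) s(2, 3) (by decide) = D.edgeClass t s(2, 3) (by decide) := by
  refine (D.edgeClass_eq _ _ 0 (by decide) (by simp [octNbr]) ?_).symm
  simp only [octPerm, true_or, if_true]
  decide

theorem sideEdge_eq (d : D.End) :
    D.sideEdge d = D.edgeClass (d.1, d.2 - 1) s(1, strandVertex d.2) (isDiag_one d.2) := by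
  rw [edgeClass_inner _ _ _ (isDiag_zero d.2)]
  · simp only [sideEdge, edgeClass, sub_add_cancel]
    rfl
  · generalize d.2 = j
    revert j; decide

theorem crossEdge_eq (d : D.End) :
    D.crossEdge d = D.edgeClass (d.1, d.2 + 1) s(0, strandVertex d.2) (isDiag_zero d.2) := by
  rw [crossEdge, edgeClass_inner _ _ _ (isDiag_zero d.2)]
  generalize d.2 = j
  revert j; decide

theorem crossEdge_two_eq (d : D.End) :
    D.crossEdge (d.1, d.2 + 2) =
      D.edgeClass (d.1, d.2 - 1) s(0, strandVertex d.2) (isDiag_zero d.2) := by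
  rw [crossEdge_eq]
  have h1 : strandVertex (d.2 + 2) = strandVertex d.2 := by
    generalize d.2 = j
    revert j; decide
  have h2 : d.2 + 2 + 1 = d.2 - 1 := by
    generalize d.2 = j
    revert j; decide
  simp only [h1, h2]

theorem sideEdge_opp {d : D.End} (hd : ¬ D.Alternating d) :
    D.sideEdge (D.opp d) = D.sideEdge d := by
  rw [sideEdge_eq (D.opp d)]
  refine (D.edgeClass_eq (isDiag_zero d.2) _ (oppositeVertex d.2) ?_ (D.octNbr_left d) ?_).symm
  · generalize d.2 = j
    revert j; decide
  · rw [octPerm_left, if_neg hd, strandVertex_opp hd]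
    generalize d.2 = j
    revert j; decide

theorem crossEdge_opp {d : D.End} (hd : ¬ D.Alternating d) :
    D.crossEdge (D.opp d) = D.crossEdge (d.1, d.2 + 2) := by
  rw [crossEdge_two_eq]
  refine (D.edgeClass_eq _ _ (oppositeVertex d.2) ?_ (D.octNbr_right d) ?_).symm
  · generalize d.2 = j
    revert j; decide
  · rw [octPerm_right, if_neg hd, strandVertex_opp hd]
    generalize d.2 = j
    revert j; decide

/-- An alternating side exchanges E and F and keeps the numbers of the horizontal vertices. Its two
outer faces thus glue the side edge at one end to both cross edges of the strand at the other: one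
face gives this lemma, the other its primed version. -/
theorem sideEdge_opp_of_alternating {d : D.End} (hd : D.Alternating d) :
    D.sideEdge (D.opp d) = D.crossEdge d := by
  rw [sideEdge_eq (D.opp d)]
  refine (D.edgeClass_eq (isDiag_one d.2) _ (oppositeVertex d.2) ?_ (D.octNbr_left d) ?_).symm
  · generalize d.2 = j
    revert j; decide
  · rw [octPerm_left, if_pos hd, strandVertex_opp_of_alternating hd]
    generalize d.2 = j
    revert j; decide

theorem sideEdge_opp_of_alternating' {d : D.End} (hd : D.Alternating d) :
    D.sideEdge (D.opp d) = D.crossEdge (d.1, d.2 + 2) := by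
  rw [crossEdge_two_eq]
  refine (D.edgeClass_eq _ _ (oppositeVertex d.2) ?_ (D.octNbr_right d) ?_).symm
  · generalize d.2 = j
    revert j; decide
  · rw [octPerm_right, if_pos hd, strandVertex_opp_of_alternating hd]
    generalize d.2 = j
    revert j; decide

/-! ### Components -/

/-- Induction along a component: a property invariant under following a side and under going
straight through a crossing is constant on it. -/
theorem iff_of_component_eq {P : D.End → Prop} (h1 : ∀ d, P (D.opp d) ↔ P d)
    (h2 : ∀ d : D.End, P (d.1, d.2 + 2) ↔ P d) {d d' : D.End}
    (h : D.component d = D.component d') : P d ↔ P d' := by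
  have := Quot.eqvGen_exact h
  induction this with
  | rel x y hxy =>
    rcases hxy with rfl | rfl
    exacts [(h1 x).symm, (h2 x).symm]
  | refl => exact Iff.rfl
  | symm x y _ ih => exact (ih (Quot.eqvGen_sound ‹_›)).symm
  | trans x y z _ _ ih ih' =>
    exact (ih (Quot.eqvGen_sound ‹_›)).trans (ih' (Quot.eqvGen_sound ‹_›))

theorem component_opp (d : D.End) : D.component (D.opp d) = D.component d :=
  Eq.symm (Quot.sound (r := fun d d' : D.End => d' = D.opp d ∨ d' = (d.1, d.2 + 2)) (Or.inl rfl))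

theorem component_add_two (d : D.End) : D.component (d.1, d.2 + 2) = D.component d :=
  Eq.symm (Quot.sound (r := fun d d' : D.End => d' = D.opp d ∨ d' = (d.1, d.2 + 2)) (Or.inr rfl))

/-- Going straight through a crossing keeps the level of the strand, so over can change to under
only along an alternating side. -/
theorem exists_alternating (hD : D.EveryComponentOverAndUnder) (c : D.Component) :
    ∃ d, D.component d = c ∧ D.Alternating d := by
  by_contra! hc
  obtain ⟨⟨d, hd, hd'⟩, ⟨e, he, he'⟩⟩ := hD c
  have := iff_of_component_eq (P := fun d => D.component d = c ∧ OverEnd d.2) (d := d) (d' := e)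
    (fun d => ?_) (fun d => ?_) (hd.trans he.symm)
  · exact he' (this.1 ⟨hd, hd'⟩).2
  · rw [component_opp]
    refine and_congr_right fun h => ?_
    have := hc d h
    simp only [Alternating, not_not] at this
    exact this.symm
  · rw [component_add_two]
    have : OverEnd (d.2 + 2) ↔ OverEnd d.2 := by
      generalize d.2 = j
      revert j; decide
    rw [this]

/-- At an end of an alternating side, both edges are glued to the side edge at the other end. Across
a non-alternating side, the pair of cross edges at one end is glued to the pair at the other, so the
identity spreads along the component. -/
theorem crossEdge_add_two (hD : D.EveryComponentOverAndUnder) (d : D.End) :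
    D.crossEdge (d.1, d.2 + 2) = D.crossEdge d := by
  have h2 : ∀ d : D.End, ((d.1, d.2 + 2 + 2) : D.End) = d := by
    rintro ⟨k, j⟩
    simp only [Prod.mk.injEq, true_and]
    revert j; decide
  obtain ⟨d', hd', h⟩ := exists_alternating hD (D.component d)
  refine (iff_of_component_eq (P := fun d => D.crossEdge (d.1, d.2 + 2) = D.crossEdge d)
    (fun d => ?_) (fun d => ?_) hd').1
    ((sideEdge_opp_of_alternating' h).symm.trans (sideEdge_opp_of_alternating h))
  · by_cases hd : D.Alternating d
    · exact iff_of_true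
        ((sideEdge_opp_of_alternating' (alternating_opp.2 hd)).symm.trans
          (sideEdge_opp_of_alternating (alternating_opp.2 hd)))
        ((sideEdge_opp_of_alternating' hd).symm.trans (sideEdge_opp_of_alternating hd))
    · have h1 := crossEdge_opp hd
      have h3 := crossEdge_opp (mt alternating_opp.1 hd)
      rw [D.opp_opp] at h3
      rw [h1, ← h3]
      exact eq_comm
  · simp only [h2]
    exact eq_comm

/-! ### The gluing equations -/

variable (D) in
/-- The sides, as a permutation of their ends. -/
def oppEquiv : D.End ≃ D.End := Function.Involutive.toPerm D.opp D.opp_opp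

variable (D) in
/-- The quarter turn around the crossings. -/
def turnEquiv : D.End ≃ D.End := Equiv.prodCongr (Equiv.refl _) (Equiv.addRight 1)

theorem oppEquiv_apply (d : D.End) : D.oppEquiv d = D.opp d := rfl

theorem turnEquiv_apply (d : D.End) : D.turnEquiv d = (d.1, d.2 + 1) := rfl

theorem turnEquiv_symm_apply (d : D.End) : D.turnEquiv.symm d = (d.1, d.2 - 1) := by
  rw [Equiv.symm_apply_eq, turnEquiv_apply]
  simp

/-- The angle of the octahedron at the edge from the horizontal vertex `d` to `F`. -/
noncomputable def overAngle (z : D.Side → ℂ) (d : D.End) : ℂ :=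
  1 / (1 - D.shape z d) * (1 - 1 / D.shape z (d.1, d.2 - 1))

/-- The angle of the octahedron at the edge from the horizontal vertex `d` to `E`. -/
noncomputable def underAngle (z : D.Side → ℂ) (d : D.End) : ℂ :=
  (1 - 1 / D.shape z d) * (1 / (1 - D.shape z (d.1, d.2 - 1)))

/-- The factor of an end, inverted at the under-ends. -/
noncomputable def signedFactor (z : D.Side → ℂ) (d : D.End) : ℂ :=
  if OverEnd d.2 then D.sideFactor z d else (D.sideFactor z d)⁻¹

/-- The angle at the edge from the horizontal vertex after `d` to the vertex of the strand of
`d`. -/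
noncomputable def crossAngle (z : D.Side → ℂ) (d : D.End) : ℂ :=
  if OverEnd d.2 then D.overAngle z (d.1, d.2 + 1) else D.underAngle z (d.1, d.2 + 1)

theorem signedFactor_ne_zero {z : D.Side → ℂ} (hz : D.Essential z) (d : D.End) :
    D.signedFactor z d ≠ 0 := by
  have := sideFactor_ne_zero hz d
  unfold signedFactor
  split_ifs
  exacts [this, inv_ne_zero this]

/-- At an essential point, the variables of neighbouring sides at a crossing are different. -/
theorem Essential.side_ne {z : D.Side → ℂ} (hz : D.Essential z) (k : D.Crossing) :
    z (D.side (k, 0)) ≠ 0 ∧ z (D.side (k, 1)) ≠ 0 ∧ z (D.side (k, 2)) ≠ 0 ∧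
      z (D.side (k, 3)) ≠ 0 ∧ z (D.side (k, 0)) - z (D.side (k, 1)) ≠ 0 ∧
      z (D.side (k, 2)) - z (D.side (k, 1)) ≠ 0 ∧ z (D.side (k, 2)) - z (D.side (k, 3)) ≠ 0 ∧
      z (D.side (k, 0)) - z (D.side (k, 3)) ≠ 0 := by
  have h : ∀ i j : Fin 4, z (D.side (k, i)) / z (D.side (k, j)) ≠ 1 →
      z (D.side (k, j)) - z (D.side (k, i)) ≠ 0 := fun i j hij h =>
    hij ((div_eq_one_iff_eq (hz.1 _)).2 (sub_eq_zero.1 h).symm)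
  exact ⟨hz.1 _, hz.1 _, hz.1 _, hz.1 _, h 1 0 (hz.2 k 0), h 1 2 (hz.2 k 1), h 3 2 (hz.2 k 2),
    h 3 0 (hz.2 k 3)⟩

theorem fin4_arith : (0 - 1 : Fin 4) = 3 ∧ (1 - 1 : Fin 4) = 0 ∧ (2 - 1 : Fin 4) = 1 ∧
    (3 - 1 : Fin 4) = 2 ∧ (0 + 1 : Fin 4) = 1 ∧ (1 + 1 : Fin 4) = 2 ∧ (2 + 1 : Fin 4) = 3 ∧
    (3 + 1 : Fin 4) = 0 ∧ (0 + 2 : Fin 4) = 2 ∧ (1 + 2 : Fin 4) = 3 ∧ (2 + 2 : Fin 4) = 0 ∧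
    (3 + 2 : Fin 4) = 1 := by decide

theorem sideFactor_apply (z : D.Side → ℂ) (k : D.Crossing) :
    D.sideFactor z (k, 0) = (1 - z (D.side (k, 1)) / z (D.side (k, 0))) /
        (1 - z (D.side (k, 3)) / z (D.side (k, 0))) ∧
      D.sideFactor z (k, 1) = (1 - z (D.side (k, 1)) / z (D.side (k, 2))) /
        (1 - z (D.side (k, 1)) / z (D.side (k, 0))) ∧
      D.sideFactor z (k, 2) = (1 - z (D.side (k, 3)) / z (D.side (k, 2))) /
        (1 - z (D.side (k, 1)) / z (D.side (k, 2))) ∧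
      D.sideFactor z (k, 3) = (1 - z (D.side (k, 3)) / z (D.side (k, 0))) /
        (1 - z (D.side (k, 3)) / z (D.side (k, 2))) :=
  ⟨rfl, rfl, rfl, rfl⟩

end LinkDiagram

namespace LinkDiagram

variable {D : LinkDiagram}

theorem ite_overEnd {α : Type*} (x y : α) : (if OverEnd 0 then x else y) = x ∧
    (if OverEnd 1 then x else y) = y ∧ (if OverEnd 2 then x else y) = x ∧
    (if OverEnd 3 then x else y) = y :=
  ⟨if_pos (by decide), if_neg (by decide), if_pos (by decide), if_neg (by decide)⟩

theorem sideAngle_eq {z : D.Side → ℂ} (hz : D.Essential z) (d : D.End) :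
    (if OverEnd d.2 then D.overAngle z d else D.underAngle z d) = (D.signedFactor z d)⁻¹ := by
  obtain ⟨k, j⟩ := d
  obtain ⟨ha, hb, hc, hd, h1, h2, h3, h4⟩ := hz.side_ne k
  have h1' := sub_ne_zero.2 (sub_ne_zero.1 h1).symm
  have h2' := sub_ne_zero.2 (sub_ne_zero.1 h2).symm
  have h3' := sub_ne_zero.2 (sub_ne_zero.1 h3).symm
  have h4' := sub_ne_zero.2 (sub_ne_zero.1 h4).symm
  have hs := sideFactor_apply z k
  rcases fin4_cases j with rfl | rfl | rfl | rfl <;>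
  · simp only [signedFactor, ite_overEnd, overAngle, underAngle, shape, hs, fin4_arith]
    field_simp

/-- The four angles of the octahedron at the edges issuing from F (or from E) multiply to 1: the
four triangles of the link each contribute -1, and the parameters at the edge EF have product 1. Two
of these angles are the inverse signed factors. -/
theorem crossAngle_mul {z : D.Side → ℂ} (hz : D.Essential z) (d : D.End) :
    D.crossAngle z d * D.crossAngle z (d.1, d.2 + 2) =
      D.signedFactor z d * D.signedFactor z (d.1, d.2 + 2) := by
  obtain ⟨k, j⟩ := d
  obtain ⟨ha, hb, hc, hd, h1, h2, h3, h4⟩ := hz.side_ne k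
  have h1' := sub_ne_zero.2 (sub_ne_zero.1 h1).symm
  have h2' := sub_ne_zero.2 (sub_ne_zero.1 h2).symm
  have h3' := sub_ne_zero.2 (sub_ne_zero.1 h3).symm
  have h4' := sub_ne_zero.2 (sub_ne_zero.1 h4).symm
  have hs := sideFactor_apply z k
  rcases fin4_cases j with rfl | rfl | rfl | rfl <;>
  · simp only [crossAngle, signedFactor, ite_overEnd, overAngle, underAngle, shape, hs, fin4_arith]
    field_simp
    try ring

open Classical in
/-- The product of the shape parameters at the edge `e`. -/
noncomputable def edgeProduct (z : D.Side → ℂ) (e : D.octahedral.Edge) : ℂ :=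
  ∏ a ∈ Finset.univ.filter
      (fun a : D.octahedral.TetEdge => Quot.mk D.octahedral.EdgeGlued a = e),
    edgeParam (D.shape z a.1) a.2.1

theorem gluingEquation_iff (z : D.Side → ℂ) (e : D.octahedral.Edge) :
    D.octahedral.GluingEquation (D.shape z) e ↔ D.edgeProduct z e = 1 := Iff.rfl

theorem edgeParam_apply (u : ℂ) : edgeParam u s(0, 1) = u ∧ edgeParam u s(2, 3) = u ∧
    edgeParam u s(0, 2) = 1 / (1 - u) ∧ edgeParam u s(1, 2) = 1 - 1 / u ∧
    edgeParam u s(0, 3) = 1 - 1 / u ∧ edgeParam u s(1, 3) = 1 / (1 - u) := by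
  refine ⟨?_, ?_, ?_, ?_, ?_, ?_⟩ <;> simp [edgeParam]

open Classical in
theorem edgeProduct_eq_prod {z : D.Side → ℂ} (hz : D.Essential z) (e : D.octahedral.Edge) :
    D.edgeProduct z e = ∏ d : D.End,
      ((if D.edgeClass d s(0, 2) (by decide) = e then D.overAngle z d else 1) *
        (if D.edgeClass d s(0, 3) (by decide) = e then D.underAngle z d else 1)) := by
  have h : D.edgeProduct z e = ∏ t : D.End, ∏ ε : {e : Sym2 (Fin 4) // ¬ e.IsDiag},
      if D.edgeClass t ε.1 ε.2 = e then edgeParam (D.shape z t) ε.1 else 1 := by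
    rw [edgeProduct, Finset.prod_filter, ← Finset.univ_product_univ, Finset.prod_product]
    rfl
  have h01 :
      (∏ t : D.End, if D.edgeClass t s(0, 1) (by decide) = e then D.shape z t else 1) = 1 := by
    -- A quarter turn followed by `opp` walks around a region; the side variable is the same at both
    -- ends of a side.
    refine Eq.trans (Finset.prod_congr rfl fun t _ => ?_)
      (prod_ite_div_eq_one (D.turnEquiv.trans D.oppEquiv)
        (fun t : D.End => D.edgeClass t s(0, 1) (by decide)) (fun t => ?_) e
        (fun t => z (D.side t)) (fun t => hz.1 _))
    · simp only [Equiv.trans_apply, turnEquiv_apply, oppEquiv_apply, side_opp]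
      rfl
    · simp only [Equiv.trans_apply, turnEquiv_apply, oppEquiv_apply]
      refine (edgeClass_zero_one _).trans ?_
      simp only [add_sub_cancel_right]
  have h23 : (∏ t : D.End, if D.edgeClass t s(2, 3) (by decide) = e then D.shape z t else 1) = 1 :=
    prod_ite_div_eq_one D.turnEquiv (fun t : D.End => D.edgeClass t s(2, 3) (by decide))
      edgeClass_two_three e (fun t => z (D.side t)) (fun t => hz.1 _)
  have h12 : (∏ t : D.End,
      if D.edgeClass t s(1, 2) (by decide) = e then 1 - 1 / D.shape z t else 1) =
      ∏ d : D.End, if D.edgeClass d s(0, 2) (by decide) = e then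
        1 - 1 / D.shape z (d.1, d.2 - 1) else 1 := by
    symm
    rw [← Equiv.prod_comp D.turnEquiv]
    refine Finset.prod_congr rfl fun t _ => ?_
    have h := edgeClass_inner t 2 (by decide) (by decide) (by decide)
    simp only [h, turnEquiv_apply, add_sub_cancel_right]
  have h13 : (∏ t : D.End,
      if D.edgeClass t s(1, 3) (by decide) = e then 1 / (1 - D.shape z t) else 1) =
      ∏ d : D.End, if D.edgeClass d s(0, 3) (by decide) = e then
        1 / (1 - D.shape z (d.1, d.2 - 1)) else 1 := by
    symm
    rw [← Equiv.prod_comp D.turnEquiv]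
    refine Finset.prod_congr rfl fun t _ => ?_
    have h := edgeClass_inner t 3 (by decide) (by decide) (by decide)
    simp only [h, turnEquiv_apply, add_sub_cancel_right]
  simp only [h, prod_tetEdge, Finset.prod_mul_distrib, edgeParam_apply, h01, h23, one_mul]
  rw [h12, h13, ← Finset.prod_mul_distrib, ← Finset.prod_mul_distrib, ← Finset.prod_mul_distrib,
    ← Finset.prod_mul_distrib]
  refine Finset.prod_congr rfl fun d _ => ?_
  simp only [overAngle, underAngle]
  split_ifs <;> simp

open Classical in
theorem edgeProduct_eq (hD : D.EveryComponentOverAndUnder) {z : D.Side → ℂ} (hz : D.Essential z)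
    (e : D.octahedral.Edge) :
    D.edgeProduct z e = ∏ d : D.End,
      ((if D.sideEdge d = e then (D.signedFactor z d)⁻¹ else 1) *
        (if D.crossEdge d = e then D.signedFactor z d else 1)) := by
  have h1 : D.edgeProduct z e =
      (∏ d : D.End, if D.sideEdge d = e then (D.signedFactor z d)⁻¹ else 1) *
        ∏ d : D.End, if D.crossEdge d = e then D.crossAngle z d else 1 := by
    -- Each horizontal vertex `d` carries two edges, to E and to F. One is the side edge of `d`, the
    -- other the cross edge of the previous end, hence the shift by a quarter turn.
    rw [edgeProduct_eq_prod hz, ← Equiv.prod_comp D.turnEquiv.symm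
      (fun d => if D.crossEdge d = e then D.crossAngle z d else 1), ← Finset.prod_mul_distrib]
    refine Finset.prod_congr rfl fun d _ => ?_
    rw [turnEquiv_symm_apply, crossEdge_eq, ← sideAngle_eq hz]
    obtain ⟨k, j⟩ := d
    rcases fin4_cases j with rfl | rfl | rfl | rfl
    · simp only [sideEdge, crossAngle, strandVertex, ite_overEnd, fin4_arith, edgeClass]
      rfl
    · simp only [sideEdge, crossAngle, strandVertex, ite_overEnd, fin4_arith, edgeClass]
      exact mul_comm _ _
    · simp only [sideEdge, crossAngle, strandVertex, ite_overEnd, fin4_arith, edgeClass]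
      rfl
    · simp only [sideEdge, crossAngle, strandVertex, ite_overEnd, fin4_arith, edgeClass]
      exact mul_comm _ _
  -- Individually the cross angle and the signed factor may differ; opposite ends have the same
  -- cross edge, and their discrepancies cancel.
  have h2 : (∏ d : D.End, if D.crossEdge d = e then D.crossAngle z d / D.signedFactor z d else 1)
      = 1 := by
    refine prod_eq_one_of_involution (fun d : D.End => (d.1, d.2 + 2)) ?_ ?_ _ ?_
    · rintro ⟨k, j⟩
      simp only [Prod.mk.injEq, true_and]
      revert j; decide
    · rintro ⟨k, j⟩
      simp only [Prod.mk.injEq, true_and, ne_eq]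
      revert j; decide
    · intro d
      simp only [crossEdge_add_two hD]
      split_ifs
      · rw [div_mul_div_comm, crossAngle_mul hz, div_self]
        exact mul_ne_zero (signedFactor_ne_zero hz _) (signedFactor_ne_zero hz _)
      · exact one_mul 1
  have h3 : (∏ d : D.End, if D.crossEdge d = e then D.crossAngle z d else 1) =
      (∏ d : D.End, if D.crossEdge d = e then D.crossAngle z d / D.signedFactor z d else 1) *
        ∏ d : D.End, if D.crossEdge d = e then D.signedFactor z d else 1 := by
    rw [← Finset.prod_mul_distrib]
    refine Finset.prod_congr rfl fun d _ => ?_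
    split_ifs
    · rw [div_mul_cancel₀ _ (signedFactor_ne_zero hz d)]
    · exact (one_mul 1).symm
  rw [h1, h3, h2, one_mul, Finset.prod_mul_distrib]

theorem signedFactor_mul {z : D.Side → ℂ} {d : D.End} (hd : ¬ D.Alternating d) :
    D.signedFactor z d * D.signedFactor z (D.opp d) = 1 ↔
      D.sideFactor z d * D.sideFactor z (D.opp d) = 1 := by
  simp only [Alternating, not_not] at hd
  simp only [signedFactor, ← hd]
  split_ifs
  · rfl
  · rw [← mul_inv, inv_eq_one]

theorem signedFactor_eq {z : D.Side → ℂ} {d : D.End} (hd : D.Alternating d)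
    (h : D.sideFactor z d * D.sideFactor z (D.opp d) = 1) :
    D.signedFactor z d = D.signedFactor z (D.opp d) := by
  simp only [Alternating] at hd
  simp only [signedFactor]
  have := eq_inv_of_mul_eq_one_left h
  split_ifs
  · tauto
  · exact this
  · rw [this, inv_inv]
  · tauto

/-- Ends of the same side cancel. Along an alternating side the signed factors agree and each side
edge is the cross edge at the other end; along a non-alternating side the factors are inverse and
the two ends share both edges. -/
theorem edgeProduct_eq_one (hD : D.EveryComponentOverAndUnder) {z : D.Side → ℂ}
    (hz : D.Essential z) (h : ∀ d : D.End, D.sideFactor z d * D.sideFactor z (D.opp d) = 1)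
    (e : D.octahedral.Edge) : D.edgeProduct z e = 1 := by
  classical
  have h1 : D.edgeProduct z e = ∏ d : D.End,
      ((if D.sideEdge d = e then (D.signedFactor z d)⁻¹ else 1) *
        (if D.crossEdge (D.opp d) = e then D.signedFactor z (D.opp d) else 1)) := by
    rw [edgeProduct_eq hD hz, Finset.prod_mul_distrib, Finset.prod_mul_distrib]
    congr 1
    exact (Equiv.prod_comp D.oppEquiv
      (fun d => if D.crossEdge d = e then D.signedFactor z d else 1)).symm
  rw [h1]
  refine prod_eq_one_of_involution D.opp D.opp_opp D.opp_ne _ fun d => ?_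
  rw [D.opp_opp]
  have hne := signedFactor_ne_zero hz
  by_cases hd : D.Alternating d
  · rw [sideEdge_opp_of_alternating hd, ← sideEdge_opp_of_alternating (alternating_opp.2 hd),
      D.opp_opp, signedFactor_eq hd (h d)]
    have := hne (D.opp d)
    split_ifs <;> field_simp
  · rw [sideEdge_opp hd, crossEdge_opp hd, crossEdge_add_two hD]
    have := eq_inv_of_mul_eq_one_left ((signedFactor_mul hd).2 (h d))
    rw [this]
    have := hne (D.opp d)
    split_ifs <;> field_simp

/-! ### The edge of a non-alternating side -/

open Classical in
/-- The non-alternating side whose edge is the one from the horizontal vertex `d` to the vertex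
`X`. -/
noncomputable def sideOfVertex (d : D.End) (X : Fin 4) : Option D.Side :=
  if X = strandVertex d.2 ∧ ¬ D.Alternating d then some (D.side d) else none

/-- The non-alternating side to whose edge an edge of a tetrahedron belongs. -/
noncomputable def sideOfTetEdge (t : D.End) (e : Sym2 (Fin 4)) : Option D.Side :=
  if e = s(0, 2) then sideOfVertex t 2
  else if e = s(0, 3) then sideOfVertex t 3
  else if e = s(1, 2) then sideOfVertex (t.1, t.2 + 1) 2
  else if e = s(1, 3) then sideOfVertex (t.1, t.2 + 1) 3
  else none

theorem sideOfTetEdge_apply (t : D.End) :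
    sideOfTetEdge t s(0, 1) = none ∧ sideOfTetEdge t s(2, 3) = none ∧
    sideOfTetEdge t s(0, 2) = sideOfVertex t 2 ∧ sideOfTetEdge t s(0, 3) = sideOfVertex t 3 ∧
    sideOfTetEdge t s(1, 2) = sideOfVertex (t.1, t.2 + 1) 2 ∧
    sideOfTetEdge t s(1, 3) = sideOfVertex (t.1, t.2 + 1) 3 := by
  refine ⟨?_, ?_, ?_, ?_, ?_, ?_⟩ <;> simp [sideOfTetEdge]

theorem sideOfVertex_strandVertex {d : D.End} (hd : ¬ D.Alternating d) :
    sideOfVertex d (strandVertex d.2) = some (D.side d) := if_pos ⟨rfl, hd⟩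

theorem sideOfVertex_of_ne {d : D.End} {X : Fin 4} (hX : X ≠ strandVertex d.2) :
    sideOfVertex d X = none := if_neg fun h => hX h.1

theorem sideOfVertex_of_alternating {d : D.End} (hd : D.Alternating d) (X : Fin 4) :
    sideOfVertex d X = none := if_neg fun h => h.2 hd

theorem sideOfTetEdge_zero (t : D.End) (j : Fin 4) :
    sideOfTetEdge t s(0, strandVertex j) = sideOfVertex t (strandVertex j) := by
  rcases strandVertex_mem j with h | h <;> simp only [h.1, sideOfTetEdge_apply]

theorem sideOfTetEdge_one (t : D.End) (j : Fin 4) :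
    sideOfTetEdge t s(1, strandVertex j) = sideOfVertex (t.1, t.2 + 1) (strandVertex j) := by
  rcases strandVertex_mem j with h | h <;> simp only [h.1, sideOfTetEdge_apply]

theorem sideOfVertex_add_one (d : D.End) :
    sideOfVertex (d.1, d.2 + 1) (strandVertex d.2) = none := by
  apply sideOfVertex_of_ne
  show strandVertex d.2 ≠ strandVertex (d.2 + 1)
  generalize d.2 = j
  revert j; decide

theorem sideOfVertex_sub_one (d : D.End) :
    sideOfVertex (d.1, d.2 - 1) (strandVertex d.2) = none := by
  apply sideOfVertex_of_ne
  show strandVertex d.2 ≠ strandVertex (d.2 - 1)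
  generalize d.2 = j
  revert j; decide

theorem tetEdge_cases (j : Fin 4) (e : Sym2 (Fin 4)) (hv : oppositeVertex j ∉ e)
    (he : ¬ e.IsDiag) : e = s(0, 1) ∨ e = s(0, strandVertex j) ∨ e = s(1, strandVertex j) := by
  revert j e; decide

theorem map_swap_two_three (j : Fin 4) (a : Fin 4) (ha : a = 0 ∨ a = 1) :
    Sym2.map (Equiv.swap 2 3) s(a, strandVertex j) = s(a, oppositeVertex j) := by
  revert a j; decide

theorem map_swap_zero_one (j : Fin 4) :
    Sym2.map (Equiv.swap 0 1) s(0, strandVertex j) = s(1, strandVertex j) ∧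
      Sym2.map (Equiv.swap 0 1) s(1, strandVertex j) = s(0, strandVertex j) := by
  revert j; decide

theorem sideOfTetEdge_left (d : D.End) {e : Sym2 (Fin 4)} (hv : oppositeVertex d.2 ∉ e)
    (he : ¬ e.IsDiag) :
    sideOfTetEdge d e = sideOfTetEdge (D.octNbr d (oppositeVertex d.2))
      (Sym2.map (D.octPerm d (oppositeVertex d.2)) e) := by
  rw [octNbr_left, octPerm_left]
  by_cases hd : D.Alternating d
  · rw [if_pos hd]
    rcases tetEdge_cases _ e hv he with rfl | rfl | rfl
    · exact (sideOfTetEdge_apply _).1.trans (sideOfTetEdge_apply _).1.symm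
    · rw [map_swap_two_three _ _ (Or.inl rfl), ← strandVertex_opp_of_alternating hd,
        sideOfTetEdge_zero, sideOfTetEdge_zero, sideOfVertex_of_alternating hd,
        sideOfVertex_sub_one]
    · rw [map_swap_two_three _ _ (Or.inr rfl), ← strandVertex_opp_of_alternating hd,
        sideOfTetEdge_one, sideOfTetEdge_one, sideOfVertex_add_one]
      simp only [sub_add_cancel]
      rw [sideOfVertex_of_alternating (alternating_opp.2 hd)]
  · rw [if_neg hd]
    have hd' := mt alternating_opp.1 hd
    rcases tetEdge_cases _ e hv he with rfl | rfl | rfl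
    · rw [show Sym2.map (Equiv.swap 0 1) s((0 : Fin 4), 1) = s(0, 1) by decide,
        (sideOfTetEdge_apply _).1, (sideOfTetEdge_apply _).1]
    · rw [(map_swap_zero_one _).1, sideOfTetEdge_zero, sideOfTetEdge_one]
      simp only [sub_add_cancel]
      rw [sideOfVertex_strandVertex hd, ← strandVertex_opp hd, sideOfVertex_strandVertex hd',
        side_opp]
    · rw [(map_swap_zero_one _).2, sideOfTetEdge_zero, sideOfTetEdge_one, sideOfVertex_add_one,
        ← strandVertex_opp hd, sideOfVertex_sub_one]

theorem sideOfTetEdge_right (d : D.End) {e : Sym2 (Fin 4)} (hv : oppositeVertex d.2 ∉ e)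
    (he : ¬ e.IsDiag) :
    sideOfTetEdge (d.1, d.2 - 1) e = sideOfTetEdge (D.octNbr (d.1, d.2 - 1) (oppositeVertex d.2))
      (Sym2.map (D.octPerm (d.1, d.2 - 1) (oppositeVertex d.2)) e) := by
  rw [octNbr_right, octPerm_right]
  by_cases hd : D.Alternating d
  · rw [if_pos hd]
    rcases tetEdge_cases _ e hv he with rfl | rfl | rfl
    · exact (sideOfTetEdge_apply _).1.trans (sideOfTetEdge_apply _).1.symm
    · rw [map_swap_two_three _ _ (Or.inl rfl), ← strandVertex_opp_of_alternating hd,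
        sideOfTetEdge_zero, sideOfTetEdge_zero, sideOfVertex_sub_one,
        sideOfVertex_of_alternating (alternating_opp.2 hd)]
    · rw [map_swap_two_three _ _ (Or.inr rfl), ← strandVertex_opp_of_alternating hd,
        sideOfTetEdge_one, sideOfTetEdge_one, sideOfVertex_add_one]
      simp only [sub_add_cancel]
      rw [sideOfVertex_of_alternating hd]
  · rw [if_neg hd]
    have hd' := mt alternating_opp.1 hd
    rcases tetEdge_cases _ e hv he with rfl | rfl | rfl
    · rw [show Sym2.map (Equiv.swap 0 1) s((0 : Fin 4), 1) = s(0, 1) by decide,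
        (sideOfTetEdge_apply _).1, (sideOfTetEdge_apply _).1]
    · rw [(map_swap_zero_one _).1, sideOfTetEdge_zero, sideOfTetEdge_one, sideOfVertex_sub_one,
        ← strandVertex_opp hd, sideOfVertex_add_one]
    · rw [(map_swap_zero_one _).2, sideOfTetEdge_zero, sideOfTetEdge_one]
      simp only [sub_add_cancel]
      rw [sideOfVertex_strandVertex hd, ← strandVertex_opp hd, sideOfVertex_strandVertex hd',
        side_opp]

/-- The label is compatible with every face gluing, so it descends to the edges of the
triangulation. -/
theorem sideOfTetEdge_eq {t t' : D.End} {e e' : Sym2 (Fin 4)} {v : Fin 4} (hv : v ∉ e)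
    (he : ¬ e.IsDiag)
    (ht : t' = D.octNbr t v) (he' : e' = Sym2.map (D.octPerm t v) e) :
    sideOfTetEdge t e = sideOfTetEdge t' e' := by
  subst ht he'
  rcases fin4_cases v with rfl | rfl | hv'
  · have h : ∀ e : Sym2 (Fin 4), 0 ∉ e → ¬ e.IsDiag → e = s(1, 2) ∨ e = s(1, 3) ∨ e = s(2, 3) := by
      decide
    have h1 : D.octNbr t 0 = (t.1, t.2 + 1) := by simp [octNbr]
    have h2 : D.octPerm t 0 = Equiv.swap 0 1 := by simp [octPerm]
    rw [h1, h2]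
    rcases h e hv he with rfl | rfl | rfl
    · exact (sideOfTetEdge_apply t).2.2.2.2.1.trans (sideOfTetEdge_apply _).2.2.1.symm
    · exact (sideOfTetEdge_apply t).2.2.2.2.2.trans (sideOfTetEdge_apply _).2.2.2.1.symm
    · exact (sideOfTetEdge_apply t).2.1.trans (sideOfTetEdge_apply _).2.1.symm
  · have h : ∀ e : Sym2 (Fin 4), 1 ∉ e → ¬ e.IsDiag → e = s(0, 2) ∨ e = s(0, 3) ∨ e = s(2, 3) := by
      decide
    have h1 : D.octNbr t 1 = (t.1, t.2 - 1) := by simp [octNbr]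
    have h2 : D.octPerm t 1 = Equiv.swap 0 1 := by simp [octPerm]
    have h3 : ((t.1, t.2 - 1 + 1) : D.End) = t := by simp
    have h4 := sideOfTetEdge_apply ((t.1, t.2 - 1) : D.End)
    simp only [h3] at h4
    rw [h1, h2]
    rcases h e hv he with rfl | rfl | rfl
    · exact (sideOfTetEdge_apply t).2.2.1.trans h4.2.2.2.2.1.symm
    · exact (sideOfTetEdge_apply t).2.2.2.1.trans h4.2.2.2.2.2.symm
    · exact (sideOfTetEdge_apply t).2.1.trans h4.2.1.symm
  · have h : ∀ j v : Fin 4, v = 2 ∨ v = 3 →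
        v = oppositeVertex j ∨ v = oppositeVertex (j + 1) := by decide
    rcases h t.2 v hv' with rfl | rfl
    · exact sideOfTetEdge_left t hv he
    · have h1 : ((t.1, t.2 + 1 - 1) : D.End) = t := by simp
      have := sideOfTetEdge_right ((t.1, t.2 + 1) : D.End) hv he
      simp only [h1] at this
      exact this

/-- The label descended to edges separates classes: cross edges and the side edges of alternating
sides get `none`, and a non-alternating side edge gets its own side. -/
theorem sideEdge_eq_iff {d : D.End} (hd : ¬ D.Alternating d) (d' : D.End) :
    (D.sideEdge d' = D.sideEdge d ↔ d' = d ∨ d' = D.opp d) ∧ D.crossEdge d' ≠ D.sideEdge d := by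
  let F : D.octahedral.Edge → Option D.Side := Quot.lift (fun a => sideOfTetEdge a.1 a.2.1)
    (by
      rintro a b ⟨v, hv, h1, h2⟩
      exact sideOfTetEdge_eq hv a.2.2 h1 h2)
  have hF1 : ∀ d, F (D.sideEdge d) = sideOfVertex d (strandVertex d.2) := by
    intro d
    exact sideOfTetEdge_zero d d.2
  have hF2 : ∀ d, F (D.crossEdge d) = none := by
    intro d
    exact (sideOfTetEdge_one d d.2).trans (sideOfVertex_add_one d)
  have hFd := (hF1 d).trans (sideOfVertex_strandVertex hd)
  refine ⟨⟨fun h => ?_, ?_⟩, fun h => ?_⟩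
  · rw [← h, hF1] at hFd
    by_cases hd' : D.Alternating d'
    · rw [sideOfVertex_of_alternating hd'] at hFd
      cases hFd
    · rw [sideOfVertex_strandVertex hd', Option.some.injEq] at hFd
      exact (D.side_eq_iff d d').1 hFd
  · rintro (rfl | rfl)
    · rfl
    · exact sideEdge_opp hd
  · rw [← h, hF2] at hFd
    cases hFd

theorem edgeProduct_sideEdge (hD : D.EveryComponentOverAndUnder) {z : D.Side → ℂ}
    (hz : D.Essential z) {d : D.End} (hd : ¬ D.Alternating d) :
    D.edgeProduct z (D.sideEdge d) = (D.signedFactor z d * D.signedFactor z (D.opp d))⁻¹ := by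
  classical
  rw [edgeProduct_eq hD hz]
  have h : ∀ d', ((if D.sideEdge d' = D.sideEdge d then (D.signedFactor z d')⁻¹ else 1) *
      (if D.crossEdge d' = D.sideEdge d then D.signedFactor z d' else 1)) =
      if d' ∈ ({d, D.opp d} : Finset D.End) then (D.signedFactor z d')⁻¹ else 1 := by
    intro d'
    simp only [(sideEdge_eq_iff hd d').1, if_neg (sideEdge_eq_iff hd d').2, mul_one,
      Finset.mem_insert, Finset.mem_singleton]
  rw [Finset.prod_congr rfl fun d' _ => h d', Finset.prod_ite_mem, Finset.univ_inter,
    Finset.prod_pair (D.opp_ne d).symm, mul_inv]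

end LinkDiagram

/-! ### Holonomy of composed curves -/

namespace IdealTriangulation

variable {T : IdealTriangulation}

theorem dilation_append (u : T.Tet → ℂ) (l l' : List CuspMove) (s : T.CuspEdge) :
    T.dilation u (l ++ l') s = T.dilation u l s * T.dilation u l' (T.endpoint l s) := by
  induction l generalizing s with
  | nil => simp [dilation, endpoint]
  | cons m l ih => simp only [List.cons_append, dilation, endpoint, ih, mul_assoc]

theorem translation_append (u : T.Tet → ℂ) (l l' : List CuspMove) (s : T.CuspEdge) :
    T.translation u (l ++ l') s =
      T.translation u l s + T.dilation u l s * T.translation u l' (T.endpoint l s) := by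
  induction l generalizing s with
  | nil => simp [translation, dilation, endpoint]
  | cons m l ih =>
    simp only [List.cons_append, translation, dilation, endpoint, ih]
    ring

end IdealTriangulation

namespace LinkDiagram

variable {D : LinkDiagram}

/-! ### Meridians -/

/-- The edge of the cusp cross-section from which the loop around a side starts. -/
def meridianBase (d : D.End) : D.octahedral.CuspEdge := ((d.1, d.2 - 1), strandFrame d.2)

open CuspMove in
theorem halfMeridian_endpoint {d : D.End} (hd : D.Alternating d) :
    D.octahedral.endpoint [turn, cross, turn, cross, flip] (meridianBase d) =
      meridianBase (D.opp d) := by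
  obtain ⟨k, i⟩ := d
  obtain ⟨k', j, c, h, h'⟩ := D.opp_cases k i
  rcases fin4_cases i with rfl | rfl | rfl | rfl <;> rcases c with rfl | rfl | rfl | rfl <;>
    simp [Alternating, OverEnd, h] at hd <;>
    simp [octahedral, meridianBase, IdealTriangulation.endpoint, IdealTriangulation.step, octNbr,
      octPerm, outerEnd, OverEnd, strandFrame, Equiv.swap_apply_def, h, swaps]
  all_goals decide

theorem edgeParam_swap (u : ℂ) : edgeParam u s(2, 0) = 1 / (1 - u) ∧
    edgeParam u s(2, 1) = 1 - 1 / u ∧ edgeParam u s(3, 0) = 1 - 1 / u ∧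
    edgeParam u s(3, 1) = 1 / (1 - u) := by
  simp only [Sym2.eq_swap (a := (2 : Fin 4)), Sym2.eq_swap (a := (3 : Fin 4)), edgeParam_apply,
    and_self]

-- `strandFrame` is odd at over-ends and even at under-ends, so the angle enters inverted in the
-- first case only. This matches the inversion in `signedFactor`, and the result is the uninverted
-- factor for both kinds.
open CuspMove in
theorem turn_dilation {z : D.Side → ℂ} (hz : D.Essential z) (d : D.End) :
    D.octahedral.dilation (D.shape z) [turn, cross, turn] (meridianBase d) =
      D.sideFactor z d := by
  have key : D.sideFactor z d = if OverEnd d.2 then (D.overAngle z d)⁻¹ else D.underAngle z d := by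
    have h := sideAngle_eq hz d
    unfold signedFactor at h
    split_ifs at h ⊢
    · rw [h, inv_inv]
    · rw [h, inv_inv]
  rw [key]
  obtain ⟨k, i⟩ := d
  rcases fin4_cases i with rfl | rfl | rfl | rfl
  · simp [octahedral, meridianBase, IdealTriangulation.dilation, IdealTriangulation.factor,
      IdealTriangulation.step, octNbr, octPerm, strandFrame, Equiv.swap_apply_def, ite_overEnd,
      edgeParam_swap, overAngle]
  · simp [octahedral, meridianBase, IdealTriangulation.dilation, IdealTriangulation.factor,
      IdealTriangulation.step, octNbr, octPerm, strandFrame, Equiv.swap_apply_def, ite_overEnd,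
      edgeParam_swap, underAngle]
    ring
  · simp [octahedral, meridianBase, IdealTriangulation.dilation, IdealTriangulation.factor,
      IdealTriangulation.step, octNbr, octPerm, strandFrame, Equiv.swap_apply_def, ite_overEnd,
      edgeParam_swap, overAngle, fin4_arith]
  · simp [octahedral, meridianBase, IdealTriangulation.dilation, IdealTriangulation.factor,
      IdealTriangulation.step, octNbr, octPerm, strandFrame, Equiv.swap_apply_def, ite_overEnd,
      edgeParam_swap, underAngle, fin4_arith]
    ring

open CuspMove in
theorem halfMeridian {z : D.Side → ℂ} (hz : D.Essential z) (d : D.End) :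
    D.octahedral.dilation (D.shape z) [turn, cross, turn, cross, flip] (meridianBase d) =
        -D.sideFactor z d ∧
      D.octahedral.dilation (D.shape z) [turn, cross, turn, flip, cross] (meridianBase d) =
        -D.sideFactor z d ∧
      D.octahedral.translation (D.shape z) [turn, cross, turn, cross, flip] (meridianBase d) =
        D.sideFactor z d ∧
      D.octahedral.translation (D.shape z) [turn, cross, turn, flip, cross] (meridianBase d) =
        D.sideFactor z d := by
  rw [← turn_dilation hz d]
  simp [IdealTriangulation.dilation, IdealTriangulation.translation, IdealTriangulation.factor,
    IdealTriangulation.displacement]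

-- The meridian consists of two halves, one about each end; the two reversals cancel in the
-- dilation, while the first one displaces the base point and produces the translation.
open CuspMove in
theorem meridian_holonomy {z : D.Side → ℂ} (hz : D.Essential z) (d : D.End)
    (hd : D.Alternating d) :
    D.octahedral.dilation (D.shape z) (D.meridian d hd).moves (D.meridian d hd).base =
        D.sideFactor z d * D.sideFactor z (D.opp d) ∧
      D.octahedral.translation (D.shape z) (D.meridian d hd).moves (D.meridian d hd).base =
        D.sideFactor z d - D.sideFactor z d * D.sideFactor z (D.opp d) := by
  obtain ⟨h1, -, h3, -⟩ := halfMeridian hz d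
  obtain ⟨-, h2, -, h4⟩ := halfMeridian hz (D.opp d)
  constructor
  · show D.octahedral.dilation (D.shape z)
      ([turn, cross, turn, cross, flip] ++ [turn, cross, turn, flip, cross]) (meridianBase d) = _
    rw [IdealTriangulation.dilation_append, halfMeridian_endpoint hd, h1, h2]
    ring
  · show D.octahedral.translation (D.shape z)
      ([turn, cross, turn, cross, flip] ++ [turn, cross, turn, flip, cross]) (meridianBase d) = _
    rw [IdealTriangulation.translation_append, halfMeridian_endpoint hd, h1, h3, h4]
    ring

theorem meridian_complete_iff {z : D.Side → ℂ} (hz : D.Essential z) (d : D.End)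
    (hd : D.Alternating d) : (D.meridian d hd).Complete (D.shape z) ↔
      D.sideFactor z d * D.sideFactor z (D.opp d) = 1 := by
  rw [IdealTriangulation.CuspLoop.Complete, (meridian_holonomy hz d hd).1]

theorem meridian_trivialHolonomy {z : D.Side → ℂ} (hz : D.Essential z) (d : D.End)
    (hd : D.Alternating d) (h : D.sideFactor z d * D.sideFactor z (D.opp d) = 1) :
    (D.meridian d hd).TrivialHolonomy (D.shape z) ↔ D.sideFactor z d = 1 := by
  rw [IdealTriangulation.CuspLoop.TrivialHolonomy, (meridian_holonomy hz d hd).1,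
    (meridian_holonomy hz d hd).2, h]
  simp [sub_eq_zero]

/-! ### Longitudes -/

/-- The edge of the cusp cross-section from which the longitude starts. -/
def longitudeBase (d : D.End) : D.octahedral.CuspEdge := (d, strandFrame d.2 * Equiv.swap 1 2)

/-- The translation vector of the meridian at the end `d`, up to a factor depending only on the
component: the diagonal of the quadrilateral cut out by the cusp, measured by its side. -/
noncomputable def meridianVector (z : D.Side → ℂ) (d : D.End) : ℂ :=
  if OverEnd d.2 then 1 - (D.sideFactor z d)⁻¹ else -(1 - (D.sideFactor z d)⁻¹)

-- With H_j H_{j+1} developed to 1, the diagonal H_{j-1} H_{j+1} of the quadrilateral is 1 -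
-- `sideFactor`⁻¹. The same diagonal, up to orientation, is computed from the opposite corner
-- H_{j+2}, whose side H_{j+1} H_{j+2} is developed to the dilation in question.
open CuspMove in
theorem pass_dilation {z : D.Side → ℂ} (hz : D.Essential z) (d : D.End) :
    D.octahedral.dilation (D.shape z) [flip, turn, cross, turn, cross] (longitudeBase d) *
      (1 - D.sideFactor z (d.1, d.2 + 2)) = -(1 - (D.sideFactor z d)⁻¹) := by
  obtain ⟨k, i⟩ := d
  obtain ⟨ha, hb, hc, hd, h1, h2, h3, h4⟩ := hz.side_ne k
  have h1' := sub_ne_zero.2 (sub_ne_zero.1 h1).symm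
  have h2' := sub_ne_zero.2 (sub_ne_zero.1 h2).symm
  have h3' := sub_ne_zero.2 (sub_ne_zero.1 h3).symm
  have h4' := sub_ne_zero.2 (sub_ne_zero.1 h4).symm
  have hs := sideFactor_apply z k
  rcases fin4_cases i with rfl | rfl | rfl | rfl
  all_goals
    simp [octahedral, longitudeBase, IdealTriangulation.dilation, IdealTriangulation.factor,
      IdealTriangulation.step, octNbr, octPerm, strandFrame, Equiv.swap_apply_def, ite_overEnd,
      edgeParam_swap, hs, shape, fin4_arith]
    field_simp
    ring

theorem alternating_of_next {d : D.End} :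
    D.Alternating (d.1, d.2 + 2) ↔ ¬ (OverEnd (D.next d).2 ↔ OverEnd d.2) := by
  have : OverEnd (d.2 + 2) ↔ OverEnd d.2 := by
    generalize d.2 = j
    revert j; decide
  rw [Alternating, next, this]
  tauto

/-- By the equation of the side, the diagonal computed on leaving a crossing is the one computed on
entering the next. The sign in `meridianVector` accounts for the final reversal in `passMoves`,
which is present exactly when the side is not alternating. -/
theorem meridianVector_eq_pass {z : D.Side → ℂ} (hz : D.Essential z)
    (h : ∀ d : D.End, D.sideFactor z d * D.sideFactor z (D.opp d) = 1) (d : D.End) :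
    D.meridianVector z d =
      D.octahedral.dilation (D.shape z) (D.passMoves d) (longitudeBase d) *
        D.meridianVector z (D.next d) := by
  have h1 := pass_dilation hz d
  have h2 : (D.sideFactor z (D.next d))⁻¹ = D.sideFactor z (d.1, d.2 + 2) :=
    (eq_inv_of_mul_eq_one_left (h (d.1, d.2 + 2))).symm
  rw [passMoves, IdealTriangulation.dilation_append]
  generalize D.octahedral.dilation (D.shape z) [.flip, .turn, .cross, .turn, .cross]
    (longitudeBase d) = A at h1 ⊢
  by_cases ha : D.Alternating (d.1, d.2 + 2)
  · have hov := alternating_of_next.1 ha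
    rw [if_pos ha]
    simp only [meridianVector, h2, IdealTriangulation.dilation, mul_one]
    split_ifs
    · tauto
    · linear_combination h1
    · linear_combination -h1
    · tauto
  · have hov := not_not.1 (mt alternating_of_next.2 ha)
    rw [if_neg ha]
    simp only [meridianVector, h2, IdealTriangulation.dilation, IdealTriangulation.factor, mul_one]
    split_ifs
    · linear_combination h1
    · tauto
    · tauto
    · linear_combination -h1

theorem meridianVector_eq_iterate {z : D.Side → ℂ} (hz : D.Essential z)
    (h : ∀ d : D.End, D.sideFactor z d * D.sideFactor z (D.opp d) = 1) (d : D.End) (n : ℕ) :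
    D.meridianVector z d =
      D.octahedral.dilation (D.shape z)
          ((List.range n).flatMap (fun m => D.passMoves (D.next^[m] d))) (longitudeBase d) *
        D.meridianVector z (D.next^[n] d) := by
  induction n with
  | zero => exact (one_mul _).symm
  | succ n ih =>
    rw [List.range_succ, List.flatMap_append, IdealTriangulation.dilation_append, longitudeBase,
      D.longitude_endpoint, List.flatMap_singleton, Function.iterate_succ_apply', mul_assoc]
    refine ih.trans (congrArg _ ?_)
    exact meridianVector_eq_pass hz h _

theorem longitude_complete {z : D.Side → ℂ} (hz : D.Essential z)
    (h : ∀ d : D.End, D.sideFactor z d * D.sideFactor z (D.opp d) = 1) (d : D.End)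
    (hd : D.sideFactor z d ≠ 1) : (D.longitude d).Complete (D.shape z) := by
  have h1 := meridianVector_eq_iterate hz h d (Function.minimalPeriod D.next d)
  rw [Function.iterate_minimalPeriod] at h1
  have h2 : D.meridianVector z d ≠ 0 := by
    have : 1 - (D.sideFactor z d)⁻¹ ≠ 0 := fun h => hd (inv_eq_one.1 (sub_eq_zero.1 h).symm)
    unfold meridianVector
    split_ifs
    exacts [this, neg_ne_zero.2 this]
  -- After one period the end is the same, so the dilation fixes a nonzero vector.
  exact (mul_eq_right₀ h2).1 h1.symm

/-- In this form the condition is visibly the same at the two opposite ends of a strand at a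
crossing, which lets it spread along a component. -/
theorem sideFactor_eq_one_iff {z : D.Side → ℂ} (hz : D.Essential z) (d : D.End) :
    D.sideFactor z d = 1 ↔ z (D.side (d.1, d.2 + 1)) = z (D.side (d.1, d.2 - 1)) := by
  obtain ⟨k, i⟩ := d
  obtain ⟨ha, hb, hc, hd, h1, h2, h3, h4⟩ := hz.side_ne k
  obtain ⟨s0, s1, s2, s3⟩ := sideFactor_apply z k
  have hne : ∀ j, 1 - D.cornerRatio z k j ≠ 0 := fun j => sub_ne_zero.2 (hz.2 k j).symm
  rcases fin4_cases i with rfl | rfl | rfl | rfl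
  · rw [s0, div_eq_one_iff_eq (show 1 - z (D.side (k, 3)) / z (D.side (k, 0)) ≠ 0 from hne 3),
      sub_right_inj,
      div_left_inj' ha, fin4_arith.1]
    rfl
  · rw [s1, div_eq_one_iff_eq (show 1 - z (D.side (k, 1)) / z (D.side (k, 0)) ≠ 0 from hne 0),
      sub_right_inj,
      div_eq_mul_inv, div_eq_mul_inv, mul_right_inj' hb, inv_inj]
    rfl
  · rw [s2, div_eq_one_iff_eq (show 1 - z (D.side (k, 1)) / z (D.side (k, 2)) ≠ 0 from hne 1),
      sub_right_inj,
      div_left_inj' hc]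
    rfl
  · rw [s3, div_eq_one_iff_eq (show 1 - z (D.side (k, 3)) / z (D.side (k, 2)) ≠ 0 from hne 2),
      sub_right_inj,
      div_eq_mul_inv, div_eq_mul_inv, mul_right_inj' hd, inv_inj]
    rfl

theorem sideFactor_eq_one_iff_of_component_eq {z : D.Side → ℂ} (hz : D.Essential z)
    (h : ∀ d : D.End, D.sideFactor z d * D.sideFactor z (D.opp d) = 1) {d d' : D.End}
    (hd : D.component d = D.component d') : D.sideFactor z d = 1 ↔ D.sideFactor z d' = 1 := by
  refine iff_of_component_eq (P := fun d => D.sideFactor z d = 1) (fun d => ?_) (fun d => ?_) hd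
  · rw [eq_inv_of_mul_eq_one_left (h d), inv_eq_one]
  · have h1 : d.2 + 2 + 1 = d.2 - 1 := by
      generalize d.2 = j
      revert j; decide
    have h2 : d.2 + 2 - 1 = d.2 + 1 := by
      generalize d.2 = j
      revert j; decide
    simp only [sideFactor_eq_one_iff hz, h1, h2]
    exact eq_comm

/-- For a knot, no meridian acts trivially: otherwise all the side variables would be equal. -/
theorem IsKnot.sideFactor_ne_one (hK : D.IsKnot) {z : D.Side → ℂ} (hz : D.Essential z)
    (h : ∀ d : D.End, D.sideFactor z d * D.sideFactor z (D.opp d) = 1) (d : D.End) :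
    D.sideFactor z d ≠ 1 := by
  intro hd
  have hK' : ∀ d d' : D.End, D.component d = D.component d' := fun d d' => hK.elim _ _
  have hall : ∀ d' : D.End, D.sideFactor z d' = 1 := fun d' =>
    (sideFactor_eq_one_iff_of_component_eq hz h (hK' d d')).1 hd
  -- If all factors are 1, the variable does not change when a strand crosses another one; on a knot
  -- it is therefore constant, and neighbouring sides at a crossing get equal values.
  have hconst : z (D.side d) = z (D.side d) ↔ z (D.side (d.1, d.2 + 1)) = z (D.side d) := by
    refine iff_of_component_eq (P := fun d' => z (D.side d') = z (D.side d)) (fun d' => ?_)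
      (fun d' => ?_) (hK' d (d.1, d.2 + 1))
    · rw [side_opp]
    · have h1 := (sideFactor_eq_one_iff hz (d'.1, d'.2 + 1)).1 (hall _)
      have h2 : d'.2 + 1 + 1 = d'.2 + 2 := by
        generalize d'.2 = j
        revert j; decide
      simp only [h2, add_sub_cancel_right] at h1
      rw [h1]
  have heq := hconst.1 rfl
  obtain ⟨k, i⟩ := d
  obtain ⟨ha, hb, hc, hd, h1, h2, h3, h4⟩ := hz.side_ne k
  rcases fin4_cases i with rfl | rfl | rfl | rfl
  · exact h1 (sub_eq_zero.2 heq.symm)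
  · exact h2 (sub_eq_zero.2 heq)
  · exact h3 (sub_eq_zero.2 heq.symm)
  · exact h4 (sub_eq_zero.2 heq)

end LinkDiagram

/-! ### The main theorem -/

theorem proposition1 (D : LinkDiagram) (hD : D.EveryComponentOverAndUnder)
    (z : D.Side → ℂ) (hz : D.Essential z) :
    -- the potential function has a branch near `z`, and for every such branch:
    (∃ f, D.IsBranchAt f z) ∧
    ∀ f, D.IsBranchAt f z →
      -- the equation of an alternating side is the completeness condition along its meridian
      (∀ (d : D.End) (hd : D.Alternating d),
        D.PotentialEquation f z (D.side d) ↔ (D.meridian d hd).Complete (D.shape z)) ∧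
      -- the equation of a non-alternating side is the gluing equation of its edge
      (∀ d : D.End, ¬ D.Alternating d →
        (D.PotentialEquation f z (D.side d) ↔
          D.octahedral.GluingEquation (D.shape z) (D.sideEdge d))) ∧
      -- the set of equations is equivalent to all gluing equations and meridian conditions
      (D.SatisfiesH f z ↔
        (∀ e : D.octahedral.Edge, D.octahedral.GluingEquation (D.shape z) e) ∧
        ∀ (d : D.End) (hd : D.Alternating d), (D.meridian d hd).Complete (D.shape z)) ∧
      -- it implies the longitude conditions at every cusp whose meridian acts non-trivially
      (D.SatisfiesH f z → ∀ (d : D.End) (hd : D.Alternating d),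
        ¬ (D.meridian d hd).TrivialHolonomy (D.shape z) →
        ∀ d' : D.End, D.component d' = D.component d →
          (D.longitude d').Complete (D.shape z)) ∧
      -- it is equivalent to all the hyperbolicity equations, always for a knot, and for a link
      -- as soon as no meridian acts as the identity
      ((D.IsKnot ∨ ∀ (d : D.End) (hd : D.Alternating d),
          ¬ (D.meridian d hd).TrivialHolonomy (D.shape z)) →
        (D.SatisfiesH f z ↔ D.HyperbolicityEquations z)) := by
  refine ⟨LinkDiagram.exists_isBranchAt hz, fun f hf => ?_⟩
  have hpot := LinkDiagram.potentialEquation_iff hz hf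
  have hmer := LinkDiagram.meridian_complete_iff hz
  have hH : D.SatisfiesH f z ↔ ∀ d : D.End, D.sideFactor z d * D.sideFactor z (D.opp d) = 1 :=
    ⟨fun h d => (hpot d).1 (h _), fun h s => by
      obtain ⟨d, rfl⟩ := Quotient.exists_rep s
      exact (hpot d).2 (h d)⟩
  have hedge : ∀ d : D.End, ¬ D.Alternating d →
      (D.PotentialEquation f z (D.side d) ↔
        D.octahedral.GluingEquation (D.shape z) (D.sideEdge d)) := by
    intro d hd
    rw [hpot, LinkDiagram.gluingEquation_iff, LinkDiagram.edgeProduct_sideEdge hD hz hd,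
      inv_eq_one, LinkDiagram.signedFactor_mul hd]
  have hall : D.SatisfiesH f z ↔
      (∀ e : D.octahedral.Edge, D.octahedral.GluingEquation (D.shape z) e) ∧
        ∀ (d : D.End) (hd : D.Alternating d), (D.meridian d hd).Complete (D.shape z) := by
    constructor
    · intro h
      exact ⟨LinkDiagram.edgeProduct_eq_one hD hz (hH.1 h), fun d hd => (hmer d hd).2 (hH.1 h d)⟩
    · rintro ⟨h1, h2⟩
      refine hH.2 fun d => ?_
      by_cases hd : D.Alternating d
      · exact (hmer d hd).1 (h2 d hd)
      · exact (hpot d).1 ((hedge d hd).2 (h1 _))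
  have hlong : D.SatisfiesH f z → ∀ (d : D.End) (hd : D.Alternating d),
      ¬ (D.meridian d hd).TrivialHolonomy (D.shape z) →
      ∀ d' : D.End, D.component d' = D.component d → (D.longitude d').Complete (D.shape z) := by
    intro h d hd hne d' hd'
    rw [LinkDiagram.meridian_trivialHolonomy hz d hd (hH.1 h d)] at hne
    exact LinkDiagram.longitude_complete hz (hH.1 h) d' fun h1 => hne
      ((LinkDiagram.sideFactor_eq_one_iff_of_component_eq hz (hH.1 h) hd').1 h1)
  refine ⟨fun d hd => (hpot d).trans (hmer d hd).symm, hedge, hall, hlong, fun hcase => ?_⟩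
  refine ⟨fun h => ⟨(hall.1 h).1, (hall.1 h).2, fun d' => ?_⟩, fun h => hall.2 ⟨h.1, h.2.1⟩⟩
  -- For a knot no end factor is 1. For a link, each component has an alternating side, and the
  -- hypothesis applies to its meridian.
  rcases hcase with hK | hne
  · exact LinkDiagram.longitude_complete hz (hH.1 h) d' (hK.sideFactor_ne_one hz (hH.1 h) d')
  · obtain ⟨d, hd, hd'⟩ := LinkDiagram.exists_alternating hD (D.component d')
    exact hlong h d hd' (hne d hd') d' hd.symm
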